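/- Let $\mathbb T^d=\mathbb R^d/\mathbb Z^d$ with its Lebesgue measure $\mathscr L^d$. For a vector field $u:[0,T]\times\mathbb T^d\to\mathbb R^d$, a trajectory starting at $x\in\mathbb T^d$ is an absolutely continuous curve $\gamma:[0,T]\to\mathbb T^d$ with $\gamma(0)=x$ and $\dot\gamma(t)=u(t,\gamma(t))$ for all $t\in[0,T]$. For $0<\nu<1$ let $\mathcal C_\nu\subset\mathbb T^d$ be the Cantor set $\bigcap_{n\ge1}\bigcup_{s}\overline Q\big(P^n_\nu(s),2^{-(1+\nu)n}\big)$, where the union is over all $s=(s_1,\dots,s_n)$ with $s_i\in\{1,-1\}^d$, $\overline Q(c,\ell)$ is the closed cube with center $c$ and side length $\ell$, and $P^n_\nu(s)$ is the point with coordinates $\frac12+\frac14\sum_{i=1}^n s_i^j\,2^{-(1+\nu)(i-1)}$, $1\le j\le d$. Theorem. For every integer $d\ge2$, all real $1\le p<d$ and $0<\alpha<1$, and every $T>0$, there exists a vector field $$u\in C([0,T];W^{1,p}(\mathbb T^d,\mathbb R^d))\cap C^\alpha([0,T]\times\mathbb T^d,\mathbb R^d)$$ such that $u(t,\cdot)$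 is divergence-free for every $t\in[0,T]$, and such that for $\mathscr L^d$-almost every $x\in\mathbb T^d$ there are at least two different trajectories of $u$ on $[0,T]$ starting at $x$. Moreover, there are $\nu\in(0,1)$ with $\mathscr L^d(\mathcal C_\nu)=0$ and a map $X:[0,T]\times\mathbb T^d\to\mathbb T^d$ such that $X(\cdot,x)$ is a trajectory of $u$ starting at $x$ for every $x\in\mathbb T^d$, and $X(T,\mathbb T^d)\subseteq\mathcal C_\nu$. -/

import Mathlib

noncomputable section

open Set MeasureTheory Filter Topology
open scoped ENNReal NNReal ContDiff

namespace TorusODE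

/-- The torus `ℝ^d / ℤ^d`. Its volume is the Lebesgue measure of total mass one. -/
abbrev Torus (d : ℕ) : Type := UnitAddTorus (Fin d)

/-- Euclidean space `ℝ^d`. -/
abbrev Vec (d : ℕ) : Type := EuclideanSpace ℝ (Fin d)

/-- The covering map `ℝ^d → ℝ^d / ℤ^d`. -/
def proj {d : ℕ} (y : Vec d) : Torus d := fun i => (y i : UnitAddCircle)

/-- Smooth real functions on the torus: those whose periodic lift to `ℝ^d` is smooth. -/
def IsSmooth {d : ℕ} (φ : Torus d → ℝ) : Prop :=
  ContDiff ℝ ∞ (fun y : Vec d => φ (proj y))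

/-- The classical partial derivative `∂φ/∂x_i` on the torus. -/
def partialDeriv {d : ℕ} (i : Fin d) (φ : Torus d → ℝ) (x : Torus d) : ℝ :=
  deriv (fun s : ℝ => φ (x + Pi.single i (s : UnitAddCircle))) 0

/-- `G i` is the weak partial derivative `∂f/∂x_i` of the integrable vector field `f`, for
every `i`. -/
structure IsWeakGradient {d : ℕ} (f : Torus d → Vec d) (G : Fin d → Torus d → Vec d) :
    Prop where
  integrable : Integrable f
  integrable_grad : ∀ i, Integrable (G i)
  integral_eq : ∀ φ : Torus d → ℝ, IsSmooth φ → ∀ i,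
    ∫ x, partialDeriv i φ x • f x = - ∫ x, φ x • G i x

/-- Membership in the Sobolev space `W^{1,p}(𝕋^d, ℝ^d)`. -/
def MemW1p {d : ℕ} (p : ℝ≥0∞) (f : Torus d → Vec d) : Prop :=
  MemLp f p ∧ ∃ G, IsWeakGradient f G ∧ ∀ i, MemLp (G i) p

/-- The Sobolev norm `‖f‖_p + ∑ i, ‖∂f/∂x_i‖_p`. The weak gradient is unique up to null sets, so
the infimum is over one value if there is a weak gradient, and it is `∞` otherwise. -/
def w1pNorm {d : ℕ} (p : ℝ≥0∞) (f : Torus d → Vec d) : ℝ≥0∞ :=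
  eLpNorm f p + ⨅ (G : Fin d → Torus d → Vec d) (_ : IsWeakGradient f G), ∑ i, eLpNorm (G i) p

/-- `u ∈ C([0,T]; W^{1,p}(𝕋^d, ℝ^d))`. -/
def IsContinuousInW1p {d : ℕ} (p : ℝ≥0∞) (T : ℝ) (u : ℝ → Torus d → Vec d) : Prop :=
  ∀ t ∈ Icc 0 T, MemW1p p (u t) ∧
    Tendsto (fun s => w1pNorm p (u s - u t)) (𝓝[Icc 0 T] t) (𝓝 0)

/-- `u ∈ C^α([0,T] × 𝕋^d, ℝ^d)`. -/
def IsHolder {d : ℕ} (α : ℝ≥0) (T : ℝ) (u : ℝ → Torus d → Vec d) : Prop :=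
  ∃ C : ℝ≥0, HolderOnWith C α (fun z : ℝ × Torus d => u z.1 z.2) (Icc 0 T ×ˢ univ)

/-- `div f = 0` in the sense of distributions. -/
def IsDivergenceFree {d : ℕ} (f : Torus d → Vec d) : Prop :=
  Integrable f ∧ ∀ φ : Torus d → ℝ, IsSmooth φ → ∫ x, ∑ i, f x i * partialDeriv i φ x = 0

/-- `γ`, restricted to `[0,T]`, is a trajectory of `u` that starts at `x`: it is absolutely
continuous, `γ 0 = x`, and `γ' t = u t (γ t)` for every `t ∈ [0,T]` (one-sided derivatives at the
end points). The velocity of `γ` is that of a lift of `γ` to `ℝ^d`. -/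
structure IsTrajectory {d : ℕ} (T : ℝ) (u : ℝ → Torus d → Vec d) (x : Torus d)
    (γ : ℝ → Torus d) : Prop where
  absolutelyContinuous : AbsolutelyContinuousOnInterval γ 0 T
  start : γ 0 = x
  ode : ∃ g : ℝ → Vec d, (∀ t ∈ Icc 0 T, γ t = proj (g t)) ∧
    ∀ t ∈ Icc 0 T, HasDerivWithinAt g (u t (γ t)) (Icc 0 T) t

/-- The initial points from which there are at least two different trajectories on `[0,T]`. -/
def nonuniquenessSet {d : ℕ} (T : ℝ) (u : ℝ → Torus d → Vec d) : Set (Torus d) :=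
  {x | ∃ γ₁ γ₂ : ℝ → Torus d, IsTrajectory T u x γ₁ ∧ IsTrajectory T u x γ₂ ∧
    ∃ t ∈ Icc 0 T, γ₁ t ≠ γ₂ t}

/-- The side length `2^{-(1+ν)n}` of the cubes of generation `n` of the Cantor set. -/
def cubeLength (ν : ℝ) (n : ℕ) : ℝ := (2 : ℝ) ^ (-((1 + ν) * n))

/-- The center of the cube of generation `n` that the sequence `s` of `n` elements of `{1,-1}^d`
encodes: its `j`-th coordinate is `1/2 + (1/4) ∑_{k<n} s_k^j 2^{-(1+ν)k}`. -/
def cubeCenter {d : ℕ} (ν : ℝ) (n : ℕ) (s : Fin n → Fin d → ℤˣ) : Torus d := fun j =>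
  ((1 / 2 + 1 / 4 * ∑ k : Fin n, ((s k j : ℤ) : ℝ) * cubeLength ν k : ℝ) : UnitAddCircle)

/-- The closed cube of side length `l` centered at `c`. -/
def closedCube {d : ℕ} (c : Torus d) (l : ℝ) : Set (Torus d) := {x | ∀ j, ‖x j - c j‖ ≤ l / 2}

/-- The union of the `2^{nd}` closed cubes of generation `n`. -/
def cantorStage (d : ℕ) (ν : ℝ) (n : ℕ) : Set (Torus d) :=
  ⋃ s : Fin n → Fin d → ℤˣ, closedCube (cubeCenter ν n s) (cubeLength ν n)

/-- The Cantor set with ratio `2^{-(1+ν)}`. -/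
def cantorSet (d : ℕ) (ν : ℝ) : Set (Torus d) := ⋂ n ∈ Ici 1, cantorStage d ν n

end TorusODE

end

/-! The time interval is cut into disjoint windows that accumulate at `0`: the window from `T / Q ^
(m + 1)` to `T / Q ^ m`, with `m = n * d + j`, belongs to generation `n` and direction `j`. In every
dyadic cell of generation `n` there are `2 ^ d` small cubes, one for each subcell, which start at
the centers of the subcells and are translated, one direction per window, to almost the center of
the cell. Fine generations move first. In terms of one coordinate, the motion of generation `n`
replaces the binary contribution `± 1 / (4 * 2 ^ n)` by the Cantor contribution `± κ ^ (n + 5) / 4`.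
Hence every point, whatever its digits, is carried into a null Cantor set (`coord_eq`,
`curve_T_mem_cantorSet`).

This is compatible with zero divergence because, when generation `n` moves, the curves have already
been gathered in cubes of tiny total volume. The field has to be a translation only on these cubes;
a stream function cut off around them gives the incompressible return flow (`derivAt_profile`,
`field_curve`).

With `Q ^ d = 2 ^ ε`, a block of generation `n` has size about `2 ^ (ε n) / 2 ^ n` and gradient
about `2 ^ (ε n) / scale` on a set of measure about `scale ^ d`, where `scale` is about `2 ^ (-ν
n)`. The gradient tends to zero in `L^p` if `ε < ν (d / p - 1)`, which is possible because `p < d`.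
Hölder continuity follows by interpolation between the supremum and the Lipschitz constant if `2 ε +
ν ≤ 1 - α`. Only one block is active at a time, so the sum of the blocks inherits these bounds
(`tendsto_eLpNorm_fieldGrad_sub`, `exists_norm_field_sub_le`).

For nonuniqueness, two copies of the field are added, with grids shifted against each other by `1/3`
in every coordinate. Since `2 ^ n / 3` stays at distance at least `1/6` from all half-integers, the
curves of one copy never meet the active block of the other (`field_shift_curve`). Every point is
thus the start of one curve of each family, and their end points differ (`curve_T_ne`). -/

noncomputable section

open Set MeasureTheory Filter Topology
open scoped ENNReal NNReal ContDiff

namespace TorusODE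

/-! ### Bump functions on the circle -/

/-- Smooth functions on `ℝ` with compact support in `(-1, 1)`. -/
structure IsBump (φ : ℝ → ℝ) : Prop where
  smooth : ContDiff ℝ ∞ φ
  tsupport_subset : tsupport φ ⊆ Ioo (-1) 1

namespace IsBump

variable {φ : ℝ → ℝ}

lemma eq_zero (h : IsBump φ) {y : ℝ} (hy : 1 ≤ |y|) : φ y = 0 := by
  by_contra hne
  have := h.tsupport_subset (subset_tsupport φ hne)
  exact absurd (abs_lt.2 this) (not_lt.2 hy)

lemma deriv (h : IsBump φ) : IsBump (deriv φ) where
  smooth := by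
    have h1 : ContDiff ℝ ((∞ : ℕ∞ω) + 1) φ := by simpa using h.smooth
    exact (contDiff_succ_iff_deriv.1 h1).2.2
  tsupport_subset :=
    (closure_minimal (support_deriv_subset) (isClosed_tsupport φ)).trans h.tsupport_subset

lemma hasDerivAt (h : IsBump φ) (y : ℝ) : HasDerivAt φ (_root_.deriv φ y) y :=
  (h.smooth.differentiable (by simp) y).hasDerivAt

lemma exists_bound (h : IsBump φ) : ∃ M, ∀ y, |φ y| ≤ M := by
  have hc : HasCompactSupport φ :=
    isCompact_Icc.of_isClosed_subset (isClosed_tsupport φ)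
      (h.tsupport_subset.trans Ioo_subset_Icc_self)
  obtain ⟨M, hM⟩ := h.smooth.continuous.bounded_above_of_compact_support hc
  exact ⟨M, hM⟩

lemma id_mul (h : IsBump φ) : IsBump fun y => y * φ y where
  smooth := contDiff_id.mul h.smooth
  tsupport_subset := (tsupport_mul_subset_right).trans h.tsupport_subset

end IsBump

/-- A bump that is bounded by `M` together with its derivative. -/
structure IsProfile (M : ℝ) (φ : ℝ → ℝ) : Prop extends IsBump φ where
  bound : ∀ y, |φ y| ≤ M
  bound_deriv : ∀ y, |deriv φ y| ≤ M

/-- A function that is supported in `(-1, 1)`, scaled by `l` and repeated with period one. -/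
def periodize (φ : ℝ → ℝ) (l : ℝ) : UnitAddCircle → ℝ :=
  Function.Periodic.lift (f := fun y : ℝ => φ ((y - round y) / l)) (c := 1) fun y => by
    simp [round_add_one]

lemma periodize_coe (φ : ℝ → ℝ) (l y : ℝ) :
    periodize φ l (y : UnitAddCircle) = φ ((y - round y) / l) := rfl

lemma round_eq_zero_of_abs_lt {y : ℝ} (hy : |y| < 1 / 2) : round y = 0 := by
  rw [round_eq_zero_iff]
  constructor <;> linarith [abs_lt.1 hy]

lemma periodize_of_abs_lt (φ : ℝ → ℝ) (l : ℝ) {y : ℝ} (hy : |y| < 1 / 2) :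
    periodize φ l (y : UnitAddCircle) = φ (y / l) := by
  rw [periodize_coe, round_eq_zero_of_abs_lt hy]
  simp

lemma coe_sub_int (y : ℝ) (k : ℤ) : ((y - k : ℝ) : UnitAddCircle) = y := by
  rw [AddCircle.coe_sub, sub_eq_self]
  exact (AddCircle.coe_eq_zero_iff 1).2 ⟨k, by simp⟩

section

variable {φ : ℝ → ℝ} {l : ℝ}

lemma periodize_eq_zero (h : IsBump φ) (hl : 0 < l) {ξ : UnitAddCircle} (hξ : l ≤ ‖ξ‖) :
    periodize φ l ξ = 0 := by
  induction ξ using QuotientAddGroup.induction_on with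
  | H y =>
    rw [UnitAddCircle.norm_eq] at hξ
    refine h.eq_zero ?_
    rw [abs_div, abs_of_pos hl, one_le_div hl]
    exact hξ

/-- The jumps of `round` lie where the bump vanishes identically; wherever the bump need not vanish,
`round` is locally constant. -/
lemma hasDerivAt_periodize_coe (h : IsBump φ) (hl : 0 < l) (hl' : l < 1 / 4) (y : ℝ) :
    HasDerivAt (fun s : ℝ => periodize φ l (s : UnitAddCircle))
      (periodize (deriv φ) l (y : UnitAddCircle) / l) y := by
  have hnorm : Continuous fun s : ℝ => ‖(s : UnitAddCircle)‖ :=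
    continuous_norm.comp (AddCircle.continuous_mk' 1)
  by_cases hy : l < ‖(y : UnitAddCircle)‖
  · rw [periodize_eq_zero h.deriv hl hy.le, zero_div]
    refine (hasDerivAt_const y (0 : ℝ)).congr_of_eventuallyEq ?_
    filter_upwards [hnorm.continuousAt.eventually (lt_mem_nhds hy)] with s hs
    exact periodize_eq_zero h hl hs.le
  · rw [UnitAddCircle.norm_eq, not_lt] at hy
    have hev : (fun s : ℝ => periodize φ l (s : UnitAddCircle)) =ᶠ[𝓝 y]
        fun s => φ ((s - round y) / l) := by
      have : ∀ᶠ s : ℝ in 𝓝 y, |s - (round y : ℝ)| < 1 / 2 := by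
        have hc : Continuous fun s : ℝ => |s - round y| := by fun_prop
        exact hc.continuousAt.eventually (gt_mem_nhds (hy.trans_lt (by linarith)))
      filter_upwards [this] with s hs
      rw [← coe_sub_int s (round y), periodize_of_abs_lt φ l hs]
    have hd := (h.hasDerivAt ((y - round y) / l)).comp y
      (((hasDerivAt_id y).sub_const (round y : ℝ)).div_const l)
    refine HasDerivAt.congr_of_eventuallyEq ?_ hev
    rw [periodize_coe]
    exact hd.congr_deriv (by ring)

lemma hasDerivAt_periodize (h : IsBump φ) (hl : 0 < l) (hl' : l < 1 / 4) (ξ : UnitAddCircle)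
    (c : ℝ) :
    HasDerivAt (fun s : ℝ => periodize φ l (ξ + ((c * s : ℝ) : UnitAddCircle)))
      (c / l * periodize (deriv φ) l ξ) 0 := by
  induction ξ using QuotientAddGroup.induction_on with
  | H y =>
    have h1 : HasDerivAt (fun s : ℝ => y + c * s) c 0 := by
      simpa using ((hasDerivAt_id (0 : ℝ)).const_mul c).const_add y
    have h2 := hasDerivAt_periodize_coe h hl hl' (y + c * 0)
    have h3 := HasDerivAt.comp (0 : ℝ) h2 h1
    simp only [mul_zero, add_zero] at h3
    exact h3.congr_deriv (by ring)

lemma abs_periodize_le {M : ℝ} (h : IsProfile M φ) (l : ℝ) (ξ : UnitAddCircle) :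
    |periodize φ l ξ| ≤ M := by
  induction ξ using QuotientAddGroup.induction_on with
  | H y => exact h.bound _

lemma abs_periodize_sub_le {M : ℝ} (h : IsProfile M φ) (hl : 0 < l) (hl' : l < 1 / 4)
    (ξ ξ' : UnitAddCircle) :
    |periodize φ l ξ - periodize φ l ξ'| ≤ M / l * ‖ξ - ξ'‖ := by
  induction ξ using QuotientAddGroup.induction_on with
  | H y =>
  induction ξ' using QuotientAddGroup.induction_on with
  | H y' =>
    -- The representative `y - k` turns the distance on the circle into a distance in `ℝ`, where the
    -- mean value inequality applies.
    set k := round (y - y') with hk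
    have hn : ‖((y : UnitAddCircle) - (y' : UnitAddCircle))‖ = |(y - k) - y'| := by
      rw [← AddCircle.coe_sub, UnitAddCircle.norm_eq]
      congr 1
      ring
    change |periodize φ l (y : UnitAddCircle) - periodize φ l (y' : UnitAddCircle)| ≤
      M / l * ‖((y : UnitAddCircle) - (y' : UnitAddCircle))‖
    rw [hn, ← coe_sub_int y k]
    have := Convex.norm_image_sub_le_of_norm_hasDerivWithin_le (s := univ) (C := M / l)
      (f := fun s : ℝ => periodize φ l (s : UnitAddCircle))
      (f' := fun s : ℝ => periodize (deriv φ) l (s : UnitAddCircle) / l)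
      (fun s _ => (hasDerivAt_periodize_coe h.toIsBump hl hl' s).hasDerivWithinAt)
      (fun s _ => by
        rw [Real.norm_eq_abs, abs_div, abs_of_pos hl]
        exact div_le_div_of_nonneg_right (h.bound_deriv _) hl.le)
      convex_univ (mem_univ y') (mem_univ (y - k))
    simpa only [Real.norm_eq_abs] using this

end

/-- Two periodized copies of `φ`, centered at `1/2 + r` and `1/2 - r`, the second with the
weight `σ`. -/
def pairBump (φ : ℝ → ℝ) (σ l r : ℝ) (ξ : UnitAddCircle) : ℝ :=
  periodize φ l (ξ - ((1 / 2 + r : ℝ) : UnitAddCircle)) +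
    σ * periodize φ l (ξ - ((1 / 2 - r : ℝ) : UnitAddCircle))

section

variable {φ : ℝ → ℝ} {l M σ : ℝ}

lemma abs_pairBump_le (h : IsProfile M φ) (hσ : |σ| = 1) (l r : ℝ) (ξ : UnitAddCircle) :
    |pairBump φ σ l r ξ| ≤ 2 * M := by
  refine (abs_add_le _ _).trans ?_
  rw [abs_mul, hσ, one_mul, two_mul]
  exact add_le_add (abs_periodize_le h _ _) (abs_periodize_le h _ _)

lemma abs_pairBump_sub_le (h : IsProfile M φ) (hσ : |σ| = 1) (hl : 0 < l) (hl' : l < 1 / 4)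
    (r r' : ℝ) (ξ ξ' : UnitAddCircle) :
    |pairBump φ σ l r ξ - pairBump φ σ l r' ξ'| ≤ 2 * M / l * (‖ξ - ξ'‖ + |r - r'|) := by
  have hM : 0 ≤ M := (abs_nonneg _).trans (h.bound 0)
  have key : ∀ a a' : ℝ, |a - a'| = |r - r'| →
      |periodize φ l (ξ - (a : UnitAddCircle)) - periodize φ l (ξ' - (a' : UnitAddCircle))| ≤
        M / l * (‖ξ - ξ'‖ + |r - r'|) := by
    intro a a' ha
    refine (abs_periodize_sub_le h hl hl' _ _).trans ?_
    gcongr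
    rw [sub_sub_sub_comm, ← ha, ← AddCircle.coe_sub]
    refine (norm_sub_le _ _).trans ?_
    gcongr
    rw [UnitAddCircle.norm_eq]
    simpa using round_le (a - a') 0
  have h1 := key (1 / 2 + r) (1 / 2 + r') (by ring_nf)
  have h2 := key (1 / 2 - r) (1 / 2 - r') (by rw [← abs_neg]; ring_nf)
  have e : pairBump φ σ l r ξ - pairBump φ σ l r' ξ' =
      (periodize φ l (ξ - ((1 / 2 + r : ℝ) : UnitAddCircle)) -
        periodize φ l (ξ' - ((1 / 2 + r' : ℝ) : UnitAddCircle))) +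
      σ * (periodize φ l (ξ - ((1 / 2 - r : ℝ) : UnitAddCircle)) -
        periodize φ l (ξ' - ((1 / 2 - r' : ℝ) : UnitAddCircle))) := by
    simp only [pairBump]; ring
  rw [e]
  refine (abs_add_le _ _).trans ?_
  rw [abs_mul, hσ, one_mul]
  calc _ ≤ _ := add_le_add h1 h2
    _ = _ := by ring

lemma hasDerivAt_pairBump (h : IsBump φ) (hl : 0 < l) (hl' : l < 1 / 4) (σ r c : ℝ)
    (ξ : UnitAddCircle) :
    HasDerivAt (fun s : ℝ => pairBump φ σ l r (ξ + ((c * s : ℝ) : UnitAddCircle)))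
      (c / l * pairBump (deriv φ) σ l r ξ) 0 := by
  have h1 := hasDerivAt_periodize h hl hl' (ξ - ((1 / 2 + r : ℝ) : UnitAddCircle)) c
  have h2 := hasDerivAt_periodize h hl hl' (ξ - ((1 / 2 - r : ℝ) : UnitAddCircle)) c
  have h3 := h1.add (h2.const_mul σ)
  simp only [pairBump]
  refine (h3.congr_deriv (by ring)).congr_of_eventuallyEq (.of_forall fun s => ?_)
  simp only [Pi.add_apply, sub_add_eq_add_sub]

lemma pairBump_eq_zero (h : IsBump φ) (hl : 0 < l) (σ r : ℝ) {ξ : UnitAddCircle}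
    (h1 : l ≤ ‖ξ - ((1 / 2 + r : ℝ) : UnitAddCircle)‖)
    (h2 : l ≤ ‖ξ - ((1 / 2 - r : ℝ) : UnitAddCircle)‖) : pairBump φ σ l r ξ = 0 := by
  rw [pairBump, periodize_eq_zero h hl h1, periodize_eq_zero h hl h2, mul_zero, add_zero]

lemma volume_union_closedBall_le (hl : 0 < l) (x y : UnitAddCircle) :
    volume (Metric.closedBall x l ∪ Metric.closedBall y l) ≤ ENNReal.ofReal (4 * l) := by
  have hb : ∀ x : UnitAddCircle, volume (Metric.closedBall x l) ≤ ENNReal.ofReal (2 * l) :=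
    fun x => by
      rw [AddCircle.volume_closedBall]
      exact ENNReal.ofReal_le_ofReal (min_le_right _ _)
  refine (measure_union_le _ _).trans ((add_le_add (hb _) (hb _)).trans ?_)
  rw [← ENNReal.ofReal_add (by positivity) (by positivity)]
  exact ENNReal.ofReal_le_ofReal (by linarith)

/-- Near `1/2 ± r` only one of the two bumps contributes. -/
lemma pairBump_eq (h : IsBump φ) (hl : 0 < l) (hl' : l < 1 / 4) {r e s : ℝ} (hs : s = 1 ∨ s = -1)
    (hr : l ≤ r) (hr' : r ≤ 1 / 4) (he : |e| ≤ l) {ξ : UnitAddCircle}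
    (hξ : ξ = ((1 / 2 + s * r + e : ℝ) : UnitAddCircle)) :
    pairBump φ σ l r ξ = (if s = 1 then 1 else σ) * φ (e / l) := by
  have he' := abs_le.1 he
  -- Used for `y = ±2 * r + e`, the position relative to the center of the other bump; `l ≤ r ≤ 1 /
  -- 4` and `l < 1 / 4` keep it in this range.
  have hnorm : ∀ y : ℝ, |y| ≤ 1 - l → l ≤ |y| → l ≤ ‖(y : UnitAddCircle)‖ := by
    intro y hy hy'
    rw [UnitAddCircle.norm_eq, abs_sub_round_eq_min]
    rcases le_or_gt 0 y with h0 | h0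
    · rw [abs_of_nonneg h0] at hy hy'
      rw [Int.fract_eq_self.2 ⟨h0, by linarith⟩]
      exact le_min (by linarith) (by linarith)
    · rw [abs_of_neg h0] at hy hy'
      have : Int.fract y = y + 1 := by
        rw [Int.fract_eq_iff]
        exact ⟨by linarith, by linarith, -1, by push_cast; ring⟩
      rw [this]
      exact le_min (by linarith) (by linarith)
  have hcase : |e| < 1 / 2 := by linarith
  rcases hs with rfl | rfl
  · have e1 : ξ - ((1 / 2 + r : ℝ) : UnitAddCircle) = (e : ℝ) := by
      rw [hξ, ← AddCircle.coe_sub]; congr 1; ring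
    have e2 : ξ - ((1 / 2 - r : ℝ) : UnitAddCircle) = ((2 * r + e : ℝ) : UnitAddCircle) := by
      rw [hξ, ← AddCircle.coe_sub]; congr 1; ring
    have h2 : l ≤ ‖((2 * r + e : ℝ) : UnitAddCircle)‖ := by
      refine hnorm _ ?_ ?_ <;> rw [abs_of_nonneg (by linarith)] <;> linarith
    rw [pairBump, e1, e2, periodize_of_abs_lt _ _ hcase, periodize_eq_zero h hl h2]
    simp
  · have e1 : ξ - ((1 / 2 - r : ℝ) : UnitAddCircle) = (e : ℝ) := by
      rw [hξ, ← AddCircle.coe_sub]; congr 1; ring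
    have e2 : ξ - ((1 / 2 + r : ℝ) : UnitAddCircle) = ((-(2 * r) + e : ℝ) : UnitAddCircle) := by
      rw [hξ, ← AddCircle.coe_sub]; congr 1; ring
    have h2 : l ≤ ‖((-(2 * r) + e : ℝ) : UnitAddCircle)‖ := by
      refine hnorm _ ?_ ?_ <;> rw [abs_of_nonpos (by linarith)] <;> linarith
    rw [pairBump, e1, e2, periodize_of_abs_lt _ _ hcase, periodize_eq_zero h hl h2]
    norm_num

end

/-! ### Integration by parts on the torus; classical and weak gradients -/

section IntegrationByParts

variable {d : ℕ}

lemma volume_torus_univ : volume (univ : Set (Torus d)) = 1 := by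
  rw [← pi_univ univ, volume_pi_pi]
  simp

lemma isOpenQuotientMap_proj : IsOpenQuotientMap (proj : Vec d → Torus d) := by
  have h1 : IsOpenQuotientMap (Pi.map fun _ : Fin d => ((↑) : ℝ → UnitAddCircle)) :=
    IsOpenQuotientMap.piMap fun _ => QuotientAddGroup.isOpenQuotientMap_mk
  exact h1.comp (EuclideanSpace.equiv (Fin d) ℝ).toHomeomorph.isOpenQuotientMap

lemma proj_add_single (y : Vec d) (i : Fin d) (s : ℝ) :
    proj (y + s • EuclideanSpace.single i (1 : ℝ)) =
      proj y + Pi.single i (s : UnitAddCircle) := by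
  funext j
  by_cases h : j = i
  · subst h; simp [proj]
  · simp [proj, h]

lemma IsSmooth.continuous {φ : Torus d → ℝ} (h : IsSmooth φ) : Continuous φ :=
  isOpenQuotientMap_proj.isQuotientMap.continuous_iff.2 (ContDiff.continuous h)

lemma IsSmooth.hasDerivAt_lift {φ : Torus d → ℝ} (h : IsSmooth φ) (i : Fin d) (y : Vec d) :
    HasDerivAt (fun s : ℝ => φ (proj y + Pi.single i (s : UnitAddCircle)))
      (fderiv ℝ (fun y => φ (proj y)) y (EuclideanSpace.single i 1)) 0 := by
  have h1 : HasDerivAt (fun s : ℝ => y + s • EuclideanSpace.single i (1 : ℝ))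
      (EuclideanSpace.single i 1) 0 := by
    simpa using ((hasDerivAt_id (0 : ℝ)).smul_const (EuclideanSpace.single i (1 : ℝ))).const_add y
  have h2 : HasFDerivAt (fun y => φ (proj y)) (fderiv ℝ (fun y => φ (proj y)) y)
      (y + (0 : ℝ) • EuclideanSpace.single i (1 : ℝ)) := by
    simpa using (ContDiff.differentiable h (by simp) y).hasFDerivAt
  have h3 := h2.comp_hasDerivAt (0 : ℝ) h1
  refine h3.congr_of_eventuallyEq (.of_forall fun s => ?_)
  simp only [Function.comp_apply, proj_add_single]

lemma IsSmooth.hasDerivAt {φ : Torus d → ℝ} (h : IsSmooth φ) (i : Fin d) (x : Torus d) :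
    HasDerivAt (fun s : ℝ => φ (x + Pi.single i (s : UnitAddCircle))) (partialDeriv i φ x) 0 := by
  obtain ⟨y, rfl⟩ := isOpenQuotientMap_proj.surjective x
  exact (h.hasDerivAt_lift i y).differentiableAt.hasDerivAt

lemma IsSmooth.continuous_partialDeriv {φ : Torus d → ℝ} (h : IsSmooth φ) (i : Fin d) :
    Continuous (partialDeriv i φ) := by
  refine isOpenQuotientMap_proj.isQuotientMap.continuous_iff.2 ?_
  have e : partialDeriv i φ ∘ proj =
      fun y => fderiv ℝ (fun y => φ (proj y)) y (EuclideanSpace.single i 1) := by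
    funext y
    exact (h.hasDerivAt_lift i y).deriv
  rw [e]
  exact (ContDiff.continuous_fderiv h (by simp)).clm_apply continuous_const

variable {E : Type*} [NormedAddCommGroup E]

lemma integrable_of_continuous {g : Torus d → E} (hg : Continuous g) : Integrable g :=
  hg.integrable_of_hasCompactSupport (HasCompactSupport.of_compactSpace g)

/-- By translation invariance the integral of `g` shifted by `s` along the `i`-th axis does not
depend on `s`; its derivative at `s = 0` is computed under the integral sign. -/
lemma integral_eq_zero_of_hasDerivAt [NormedSpace ℝ E] {g g' : Torus d → E} (i : Fin d)
    (hg : Continuous g) (hg' : Continuous g')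
    (h : ∀ x, HasDerivAt (fun s : ℝ => g (x + Pi.single i (s : UnitAddCircle))) (g' x) 0) :
    ∫ x, g' x = 0 := by
  obtain ⟨C, hC⟩ := isCompact_univ.exists_bound_of_continuousOn hg'.continuousOn
  have hder : ∀ (x : Torus d) (s : ℝ),
      HasDerivAt (fun s : ℝ => g (x + Pi.single i (s : UnitAddCircle)))
        (g' (x + Pi.single i (s : UnitAddCircle))) s := by
    intro x s
    have h1 := h (x + Pi.single i (s : UnitAddCircle))
    have h1' : HasDerivAt (fun s' : ℝ => g (x + Pi.single i (s : UnitAddCircle) +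
        Pi.single i (s' : UnitAddCircle))) (g' (x + Pi.single i (s : UnitAddCircle))) (s - s) := by
      simpa using h1
    have h3 := HasDerivAt.comp_sub_const s s h1'
    refine h3.congr_of_eventuallyEq (.of_forall fun s' => ?_)
    simp only [add_assoc, ← Pi.single_add, ← AddCircle.coe_add]
    simp
  have hcont : ∀ s : ℝ, Continuous fun x : Torus d => x + Pi.single i (s : UnitAddCircle) :=
    fun s => continuous_id.add continuous_const
  let F (k : Torus d → E) (s : ℝ) (x : Torus d) : E := k (x + Pi.single i (s : UnitAddCircle))
  have hint : ∀ (k : Torus d → E) (s : ℝ), Continuous k → Integrable (F k s) := fun k s hk =>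
    integrable_of_continuous (hk.comp (hcont s))
  have key := (hasDerivAt_integral_of_dominated_loc_of_deriv_le (μ := (volume : Measure (Torus d)))
    (F := F g) (F' := F g') (x₀ := (0 : ℝ)) (s := univ) (bound := fun _ => C) univ_mem
    (.of_forall fun s => (hint g s hg).aestronglyMeasurable) (hint g 0 hg)
    (hint g' 0 hg').aestronglyMeasurable
    (.of_forall fun x s _ => hC _ (mem_univ _)) (integrable_const C)
    (.of_forall fun x s _ => hder x s)).2
  have hconst : (fun s : ℝ => ∫ x, F g s x) = fun _ => ∫ x, g x := by
    funext s
    exact integral_add_right_eq_self g _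
  rw [hconst] at key
  have := key.unique (hasDerivAt_const _ _)
  simpa [F] using this

/-- `G i` is the classical continuous partial derivative `∂f/∂x_i`, for every `i`. -/
structure HasGradient (f : Torus d → Vec d) (G : Fin d → Torus d → Vec d) : Prop where
  continuous : Continuous f
  continuous_grad : ∀ i, Continuous (G i)
  hasDerivAt : ∀ i x, HasDerivAt (fun s : ℝ => f (x + Pi.single i (s : UnitAddCircle))) (G i x) 0

lemma HasGradient.isWeakGradient {f : Torus d → Vec d} {G : Fin d → Torus d → Vec d}
    (h : HasGradient f G) : IsWeakGradient f G where
  integrable := integrable_of_continuous h.continuous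
  integrable_grad i := integrable_of_continuous (h.continuous_grad i)
  integral_eq φ hφ i := by
    have c1 : Continuous fun x => partialDeriv i φ x • f x :=
      (hφ.continuous_partialDeriv i).smul h.continuous
    have c2 : Continuous fun x => φ x • G i x := hφ.continuous.smul (h.continuous_grad i)
    have := integral_eq_zero_of_hasDerivAt i (hφ.continuous.smul h.continuous) (c2.add c1)
      fun x => by
        have := (hφ.hasDerivAt i x).fun_smul (h.hasDerivAt i x)
        simpa using this
    rw [integral_add' (integrable_of_continuous c2) (integrable_of_continuous c1)] at this
    exact eq_neg_of_add_eq_zero_right this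

lemma HasGradient.isDivergenceFree {f : Torus d → Vec d} {G : Fin d → Torus d → Vec d}
    (h : HasGradient f G) (hdiv : ∀ x, ∑ i, G i x i = 0) : IsDivergenceFree f := by
  refine ⟨integrable_of_continuous h.continuous, fun φ hφ => ?_⟩
  have happ : ∀ i : Fin d, Continuous fun v : Vec d => v i := fun i =>
    (EuclideanSpace.proj i : Vec d →L[ℝ] ℝ).continuous
  have hint : ∀ i, Integrable fun x => f x i * partialDeriv i φ x := fun i =>
    integrable_of_continuous (((happ i).comp h.continuous).mul (hφ.continuous_partialDeriv i))
  have hint' : ∀ i, Integrable fun x => φ x * G i x i := fun i =>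
    integrable_of_continuous (hφ.continuous.mul ((happ i).comp (h.continuous_grad i)))
  have hi : ∀ i, ∫ x, f x i * partialDeriv i φ x = - ∫ x, φ x * G i x i := by
    intro i
    have c1 : Continuous fun x => partialDeriv i φ x • f x :=
      (hφ.continuous_partialDeriv i).smul h.continuous
    have c2 : Continuous fun x => φ x • G i x := hφ.continuous.smul (h.continuous_grad i)
    have h0 := congrArg (EuclideanSpace.proj i : Vec d →L[ℝ] ℝ)
      (h.isWeakGradient.integral_eq φ hφ i)
    rw [map_neg, ← ContinuousLinearMap.integral_comp_comm _
      (integrable_of_continuous c1),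
      ← ContinuousLinearMap.integral_comp_comm _
      (integrable_of_continuous c2)] at h0
    simpa [mul_comm] using h0
  rw [integral_finsetSum _ fun i _ => hint i]
  simp only [hi]
  rw [Finset.sum_neg_distrib, ← integral_finsetSum _ fun i _ => hint' i]
  simp [← Finset.mul_sum, hdiv]

lemma HasGradient.sub {f f' : Torus d → Vec d} {G G' : Fin d → Torus d → Vec d}
    (h : HasGradient f G) (h' : HasGradient f' G') : HasGradient (f - f') (fun i => G i - G' i) where
  continuous := h.continuous.sub h'.continuous
  continuous_grad i := (h.continuous_grad i).sub (h'.continuous_grad i)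
  hasDerivAt i x := (h.hasDerivAt i x).sub (h'.hasDerivAt i x)

lemma HasGradient.add {f f' : Torus d → Vec d} {G G' : Fin d → Torus d → Vec d}
    (h : HasGradient f G) (h' : HasGradient f' G') : HasGradient (f + f') (fun i => G i + G' i) where
  continuous := h.continuous.add h'.continuous
  continuous_grad i := (h.continuous_grad i).add (h'.continuous_grad i)
  hasDerivAt i x := (h.hasDerivAt i x).add (h'.hasDerivAt i x)

lemma memLp_of_continuous {g : Torus d → E} (hg : Continuous g) (p : ℝ≥0∞) : MemLp g p := by
  obtain ⟨C, hC⟩ := isCompact_univ.exists_bound_of_continuousOn hg.continuousOn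
  exact MemLp.of_bound (integrable_of_continuous hg).aestronglyMeasurable C
    (.of_forall fun x => hC x (mem_univ x))

lemma HasGradient.memW1p {f : Torus d → Vec d} {G : Fin d → Torus d → Vec d}
    (h : HasGradient f G) (p : ℝ≥0∞) : MemW1p p f :=
  ⟨memLp_of_continuous h.continuous p, G, h.isWeakGradient,
    fun i => memLp_of_continuous (h.continuous_grad i) p⟩

lemma HasGradient.w1pNorm_le {f : Torus d → Vec d} {G : Fin d → Torus d → Vec d}
    (h : HasGradient f G) (p : ℝ≥0∞) :
    w1pNorm p f ≤ eLpNorm f p + ∑ i, eLpNorm (G i) p := by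
  unfold w1pNorm
  gcongr
  exact iInf₂_le G h.isWeakGradient

/-- If a time-dependent field has classical gradients that depend continuously on time in `L^p`,
then it is continuous in `W^{1,p}`. -/
lemma isContinuousInW1p_of_hasGradient {p : ℝ≥0∞} {T : ℝ} {u : ℝ → Torus d → Vec d}
    {G : ℝ → Fin d → Torus d → Vec d} (h : ∀ t, HasGradient (u t) (G t))
    (hu : ∀ t, Tendsto (fun s => eLpNorm (u s - u t) p) (𝓝 t) (𝓝 0))
    (hG : ∀ t i, Tendsto (fun s => eLpNorm (G s i - G t i) p) (𝓝 t) (𝓝 0)) :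
    IsContinuousInW1p p T u := by
  refine fun t _ => ⟨(h t).memW1p p, Tendsto.mono_left ?_ nhdsWithin_le_nhds⟩
  have hlim : Tendsto (fun s => eLpNorm (u s - u t) p + ∑ i, eLpNorm (G s i - G t i) p)
      (𝓝 t) (𝓝 0) := by
    simpa using (hu t).add (tendsto_finsetSum Finset.univ fun i _ => hG t i)
  exact tendsto_of_tendsto_of_tendsto_of_le_of_le tendsto_const_nhds hlim (fun _ => zero_le)
    fun s => ((h s).sub (h t)).w1pNorm_le p

end IntegrationByParts

/-! ### General estimates for norms, products and volumes -/

/-- A bound for the `L^p` norm of a bounded function that is supported in a small set. -/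
lemma eLpNorm_le_of_support {X E : Type*} [MeasurableSpace X] {μ : Measure X}
    [NormedAddCommGroup E] {f : X → E} {C : ℝ} {s : Set X} (hC : ∀ x, ‖f x‖ ≤ C)
    (hs : Function.support f ⊆ s) (p : ℝ≥0∞) :
    eLpNorm f p μ ≤ μ s ^ p.toReal⁻¹ * ENNReal.ofReal C := by
  rw [← eLpNorm_restrict_eq_of_support_subset hs]
  refine (eLpNorm_le_of_ae_bound (.of_forall hC)).trans ?_
  rw [Measure.restrict_apply_univ]

/-- A sum of time-dependent functions, of which at most one is nonzero at each time, is continuous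
in `L^p` if the summands are and tend to zero in `L^p`, uniformly in time. -/
lemma tendsto_eLpNorm_tsum_sub {ι X E : Type*} [MeasurableSpace X] {μ : Measure X}
    [NormedAddCommGroup E] {p : ℝ≥0∞} (hp : 1 ≤ p)
    {V : ι → ℝ → X → E} (hV : ∀ m t, AEStronglyMeasurable (V m t) μ)
    (hdisj : ∀ t, ∃ m, ∀ m' ≠ m, V m' t = 0)
    (hsmall : ∀ ε : ℝ≥0∞, 0 < ε → ∀ᶠ m in cofinite, ∀ t, eLpNorm (V m t) p μ ≤ ε)
    (hcont : ∀ m t, Tendsto (fun s => eLpNorm (V m s - V m t) p μ) (𝓝 t) (𝓝 0)) (t : ℝ) :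
    Tendsto (fun s => eLpNorm ((fun x => ∑' m, V m s x) - fun x => ∑' m, V m t x) p μ)
      (𝓝 t) (𝓝 0) := by
  rw [ENNReal.tendsto_nhds_zero]
  intro ε hε
  have hε4 : 0 < ε / 4 := ENNReal.div_pos hε.ne' (by simp)
  have hfin : {m | ¬ ∀ t, eLpNorm (V m t) p μ ≤ ε / 4}.Finite := hsmall _ hε4
  -- Only finitely many summands are not uniformly small, and these are continuous one by one; for
  -- the others each of the two terms is at most `ε / 4`.
  have hunif : ∀ᶠ s in 𝓝 t, ∀ m, eLpNorm (V m s - V m t) p μ ≤ ε / 2 := by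
    have h1 : ∀ᶠ s in 𝓝 t, ∀ m ∈ {m | ¬ ∀ t, eLpNorm (V m t) p μ ≤ ε / 4},
        eLpNorm (V m s - V m t) p μ ≤ ε / 2 :=
      (Filter.eventually_all_finite hfin).2 fun m _ =>
        ENNReal.tendsto_nhds_zero.1 (hcont m t) _ (ENNReal.div_pos hε.ne' (by simp))
    filter_upwards [h1] with s hs m
    by_cases hm : ∀ t, eLpNorm (V m t) p μ ≤ ε / 4
    · refine (eLpNorm_sub_le (hV m s) (hV m t) hp).trans ((add_le_add (hm s) (hm t)).trans ?_)
      rw [← two_mul, ← mul_div_assoc, show (4 : ℝ≥0∞) = 2 * 2 by norm_num]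
      exact (ENNReal.mul_div_mul_left ε 2 (by simp) (by simp)).le
    · exact hs m hm
  filter_upwards [hunif] with s hs
  obtain ⟨m, hm⟩ := hdisj s
  obtain ⟨m', hm'⟩ := hdisj t
  have es : (fun x => ∑' m, V m s x) = V m s := by
    funext x
    exact tsum_eq_single m fun n hn => by rw [hm n hn]; rfl
  have et : (fun x => ∑' m, V m t x) = V m' t := by
    funext x
    exact tsum_eq_single m' fun n hn => by rw [hm' n hn]; rfl
  rw [es, et]
  by_cases hmm : m = m'
  · subst hmm
    exact (hs m).trans ENNReal.half_le_self
  -- Summand `m` vanishes at time `t` and summand `m'` at time `s`, so a change of the active index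
  -- is the sum of two differences with a fixed index.
  · have e : V m s - V m' t = (V m s - V m t) + (V m' s - V m' t) := by
      rw [hm' m hmm, hm m' (Ne.symm hmm)]; simp [sub_eq_add_neg]
    rw [e]
    refine (eLpNorm_add_le ((hV m s).sub (hV m t)) ((hV m' s).sub (hV m' t)) hp).trans ?_
    exact (add_le_add (hs m) (hs m')).trans (ENNReal.add_halves ε).le

lemma abs_prod_sub_prod_le {ι : Type*} (s : Finset ι) {a b : ι → ℝ} {B δ : ℝ} (hB : 1 ≤ B)
    (hδ : 0 ≤ δ) (ha : ∀ i, |a i| ≤ B) (hb : ∀ i, |b i| ≤ B) (hab : ∀ i, |a i - b i| ≤ δ) :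
    |∏ i ∈ s, a i - ∏ i ∈ s, b i| ≤ s.card * B ^ s.card * δ := by
  classical
  have hB0 : 0 ≤ B := by linarith
  induction s using Finset.induction_on with
  | empty => simp
  | insert i s hi ih =>
    rw [Finset.prod_insert hi, Finset.prod_insert hi, Finset.card_insert_of_notMem hi]
    have hp : |∏ i ∈ s, b i| ≤ B ^ s.card := by
      rw [Finset.abs_prod]
      exact (Finset.prod_le_prod (fun i _ => abs_nonneg _) fun i _ => hb i).trans (by simp)
    have hp' : B ^ s.card ≤ B ^ (s.card + 1) := pow_le_pow_right₀ hB (Nat.le_succ _)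
    calc |a i * ∏ i ∈ s, a i - b i * ∏ i ∈ s, b i|
        = |a i * (∏ i ∈ s, a i - ∏ i ∈ s, b i) + (a i - b i) * ∏ i ∈ s, b i| := by
          congr 1; ring
      _ ≤ |a i| * |∏ i ∈ s, a i - ∏ i ∈ s, b i| + |a i - b i| * |∏ i ∈ s, b i| := by
          rw [← abs_mul, ← abs_mul]; exact abs_add_le _ _
      _ ≤ B * (s.card * B ^ s.card * δ) + δ * B ^ (s.card + 1) := by
          gcongr
          · exact ha i
          · exact hab i
          · exact hp.trans hp'
      _ = ((s.card + 1 : ℕ) : ℝ) * B ^ (s.card + 1) * δ := by push_cast; ring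

/-- Multiplication by a nonzero integer preserves the Haar measure of the circle, so the number of
cells does not enter the bound. -/
lemma volume_forall_nsmul_sub_mem_le {d N : ℕ} (hN : N ≠ 0) (b : Torus d)
    (A : Fin d → Set UnitAddCircle) (hA : ∀ i, MeasurableSet (A i)) {c : ℝ≥0∞}
    (hc : ∀ i, volume (A i) ≤ c) :
    volume {x : Torus d | ∀ i, N • (x i - b i) ∈ A i} ≤ c ^ d := by
  have e : {x : Torus d | ∀ i, N • (x i - b i) ∈ A i} =
      Set.pi univ fun i => (fun y : UnitAddCircle => N • (y - b i)) ⁻¹' A i := by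
    ext x; simp
  rw [e, volume_pi_pi]
  refine (Finset.prod_le_pow_card _ _ c fun i _ => ?_).trans (by simp)
  have hm : MeasurePreserving (fun y : UnitAddCircle => N • (y - b i)) := by
    have := (Measure.measurePreserving_zsmul (volume : Measure UnitAddCircle)
      (Int.natCast_ne_zero.2 hN)).comp (measurePreserving_sub_right volume (b i))
    simpa [Function.comp_def] using this
  rw [hm.measure_preimage (hA i).nullMeasurableSet]
  exact hc i

/-! ### Parameters, time steps and profiles -/

/-- The parameters of the construction: the time `T`, the factor `Q` by which the time intervals
shrink, and the exponent `ν` of the Cantor set. -/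
structure Setup (d : ℕ) where
  T : ℝ
  Q : ℝ
  ν : ℝ
  T_pos : 0 < T
  one_lt_Q : 1 < Q
  ν_pos : 0 < ν
  ν_lt_one : ν < 1
  two_le : 2 ≤ d

namespace Setup

variable {d : ℕ} (P : Setup d)

/-- The ratio `2^{-(1+ν)}` of the Cantor set. -/
def κ : ℝ := (2 : ℝ) ^ (-(1 + P.ν))

lemma κ_pos : 0 < P.κ := Real.rpow_pos_of_pos two_pos _

lemma κ_lt : P.κ < 1 / 2 := by
  have : P.κ < (2 : ℝ) ^ (-1 : ℝ) :=
    Real.rpow_lt_rpow_of_exponent_lt one_lt_two (by linarith [P.ν_pos])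
  rwa [Real.rpow_neg_one, ← one_div] at this

lemma cubeLength_eq (n : ℕ) : cubeLength P.ν n = P.κ ^ n := by
  rw [cubeLength, κ, ← Real.rpow_natCast, ← Real.rpow_mul two_pos.le]
  congr 1; ring

/-- In the unit of a cell of generation `n`, half the side length of the moving cubes of generation
`n + 1`, including a margin. -/
def scale (n : ℕ) : ℝ := P.κ ^ 5 * (2 * P.κ) ^ n / 4

lemma scale_pos (n : ℕ) : 0 < P.scale n := by
  have := P.κ_pos
  unfold scale; positivity

/-- This is the purpose of the factor `κ ^ 5` in `scale`: the separation of the two shifted families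
needs `24 * scale < 1`. -/
lemma scale_le (n : ℕ) : P.scale n ≤ 1 / 128 := by
  have h0 := P.κ_pos
  have h1 := P.κ_lt
  have h2 : P.κ ^ 5 ≤ (1 / 2) ^ 5 := pow_le_pow_left₀ h0.le h1.le 5
  have h3 : (2 * P.κ) ^ n ≤ 1 := pow_le_one₀ (by linarith) (by linarith)
  have h4 : P.κ ^ 5 * (2 * P.κ) ^ n ≤ (1 / 2) ^ 5 * 1 := by gcongr
  unfold scale
  linarith

lemma scale_lt (n : ℕ) : P.scale n < 1 / 4 := (P.scale_le n).trans_lt (by norm_num)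

/-- A smooth step from `0` at time `T / Q` to `1` at time `T`. -/
def step (τ : ℝ) : ℝ := Real.smoothTransition ((τ / P.T - P.Q⁻¹) / (1 - P.Q⁻¹))

lemma Q_pos : 0 < P.Q := one_pos.trans P.one_lt_Q

lemma Q_inv_lt_one : P.Q⁻¹ < 1 := inv_lt_one_of_one_lt₀ P.one_lt_Q

lemma contDiff_step : ContDiff ℝ ∞ P.step := by
  unfold step
  exact Real.smoothTransition.contDiff.comp
    (((contDiff_id.div_const _).sub contDiff_const).div_const _)

lemma step_eq_zero {τ : ℝ} (h : P.Q * τ ≤ P.T) : P.step τ = 0 := by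
  refine Real.smoothTransition.zero_of_nonpos (div_nonpos_of_nonpos_of_nonneg ?_ ?_)
  · rw [sub_nonpos, div_le_iff₀ P.T_pos, ← div_eq_inv_mul, le_div_iff₀ P.Q_pos]
    linarith
  · linarith [P.Q_inv_lt_one]

lemma step_eq_one {τ : ℝ} (h : P.T ≤ τ) : P.step τ = 1 := by
  have := P.Q_inv_lt_one
  refine Real.smoothTransition.one_of_one_le ?_
  rw [one_le_div (by linarith)]
  have : 1 ≤ τ / P.T := by rwa [one_le_div P.T_pos]
  linarith

lemma step_nonneg (τ : ℝ) : 0 ≤ P.step τ := Real.smoothTransition.nonneg _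

lemma step_le_one (τ : ℝ) : P.step τ ≤ 1 := Real.smoothTransition.le_one _

lemma hasDerivAt_step (τ : ℝ) : HasDerivAt P.step (deriv P.step τ) τ :=
  (P.contDiff_step.differentiable (by simp) τ).hasDerivAt

/-- Outside the open window, and at its end points, the step attains its minimum `0` or its maximum
`1`, so its derivative vanishes there. -/
lemma lt_of_deriv_step_ne_zero {τ : ℝ} (h : deriv P.step τ ≠ 0) : P.T < P.Q * τ ∧ τ < P.T := by
  constructor <;> by_contra hn <;> rw [not_lt] at hn
  · refine h (IsLocalMin.deriv_eq_zero (.of_forall fun s => ?_))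
    rw [P.step_eq_zero hn]
    exact P.step_nonneg s
  · refine h (IsLocalMax.deriv_eq_zero (.of_forall fun s => ?_))
    rw [P.step_eq_one hn]
    exact P.step_le_one s

lemma pos_of_deriv_step_ne_zero {t : ℝ} {m : ℕ} (h : deriv P.step (P.Q ^ m * t) ≠ 0) : 0 < t := by
  have h1 := P.T_pos.trans (P.lt_of_deriv_step_ne_zero h).1
  exact pos_of_mul_pos_right (pos_of_mul_pos_right h1 P.Q_pos.le) (pow_pos P.Q_pos m).le

/-- Larger indices belong to earlier windows: while index `m` moves, all larger ones have finished
and, by `step_of_gt`, all smaller ones have not begun. -/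
lemma step_of_lt {t : ℝ} {m m' : ℕ} (h : deriv P.step (P.Q ^ m * t) ≠ 0) (hm : m < m') :
    P.step (P.Q ^ m' * t) = 1 := by
  obtain ⟨h1, h2⟩ := P.lt_of_deriv_step_ne_zero h
  refine P.step_eq_one (h1.le.trans ?_)
  have ht := P.pos_of_deriv_step_ne_zero h
  rw [← mul_assoc, ← pow_succ']
  gcongr
  · exact P.one_lt_Q.le
  · omega

lemma step_of_gt {t : ℝ} {m m' : ℕ} (h : deriv P.step (P.Q ^ m * t) ≠ 0) (hm : m' < m) :
    P.step (P.Q ^ m' * t) = 0 := by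
  obtain ⟨h1, h2⟩ := P.lt_of_deriv_step_ne_zero h
  refine P.step_eq_zero (le_trans ?_ h2.le)
  have ht := P.pos_of_deriv_step_ne_zero h
  rw [← mul_assoc, ← pow_succ']
  gcongr
  · exact P.one_lt_Q.le
  · omega

lemma deriv_step_eq_zero_of_ne {t : ℝ} {m m' : ℕ} (h : deriv P.step (P.Q ^ m * t) ≠ 0)
    (hm : m' ≠ m) : deriv P.step (P.Q ^ m' * t) = 0 := by
  rcases lt_or_gt_of_ne hm with hlt | hlt
  · refine IsLocalMin.deriv_eq_zero (.of_forall fun s => ?_)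
    rw [P.step_of_gt h hlt]
    exact P.step_nonneg s
  · refine IsLocalMax.deriv_eq_zero (.of_forall fun s => ?_)
    rw [P.step_of_lt h hlt]
    exact P.step_le_one s

/-- A bump that is `1` in a neighborhood of `[-2κ, 2κ]`. -/
def η : ℝ → ℝ :=
  (⟨(1 + 2 * P.κ) / 2, (3 + 2 * P.κ) / 4, by linarith [P.κ_pos], by linarith [P.κ_lt]⟩ :
    ContDiffBump (0 : ℝ))

/-- A bump that is the identity in a neighborhood of `[-2κ, 2κ]`. -/
def ζ (y : ℝ) : ℝ := y * P.η y

lemma isBump_η : IsBump P.η where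
  smooth := ContDiffBump.contDiff _
  tsupport_subset := by
    unfold η
    rw [ContDiffBump.tsupport_eq, Real.closedBall_eq_Icc]
    have := P.κ_lt
    intro y hy
    simp only [mem_Icc, zero_sub, zero_add] at hy
    exact ⟨by linarith [hy.1], by linarith [hy.2]⟩

lemma isBump_ζ : IsBump P.ζ := P.isBump_η.id_mul

lemma η_eventuallyEq {y : ℝ} (hy : |y| ≤ 2 * P.κ) : P.η =ᶠ[𝓝 y] 1 := by
  refine ContDiffBump.eventuallyEq_one_of_mem_ball _ ?_
  rw [Real.ball_eq_Ioo]
  have := P.κ_lt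
  have h := abs_le.1 hy
  exact ⟨by simp only [zero_sub]; linarith [h.1], by simp only [zero_add]; linarith [h.2]⟩

lemma η_eq_one {y : ℝ} (hy : |y| ≤ 2 * P.κ) : P.η y = 1 := (P.η_eventuallyEq hy).eq_of_nhds

lemma deriv_η_eq_zero {y : ℝ} (hy : |y| ≤ 2 * P.κ) : deriv P.η y = 0 := by
  rw [(P.η_eventuallyEq hy).deriv_eq]
  exact deriv_const y (1 : ℝ)

lemma deriv_ζ_eq_one {y : ℝ} (hy : |y| ≤ 2 * P.κ) : deriv P.ζ y = 1 := by
  have : P.ζ =ᶠ[𝓝 y] id := by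
    filter_upwards [P.η_eventuallyEq hy] with s hs
    simp [ζ, hs]
  rw [this.deriv_eq, deriv_id]

/-- `M` bounds all functions of one variable that occur in the construction. -/
structure IsBound (M : ℝ) : Prop where
  one_le : 1 ≤ M
  η₀ : IsProfile M P.η
  η₁ : IsProfile M (deriv P.η)
  η₂ : IsProfile M (deriv (deriv P.η))
  ζ₀ : IsProfile M P.ζ
  ζ₁ : IsProfile M (deriv P.ζ)
  ζ₂ : IsProfile M (deriv (deriv P.ζ))
  abs_deriv_step : ∀ τ, |deriv P.step τ| ≤ M
  abs_deriv_deriv_step : ∀ τ, |deriv (deriv P.step) τ| ≤ M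

lemma contDiff_deriv_step : ContDiff ℝ ∞ (deriv P.step) := by
  have h1 : ContDiff ℝ ((∞ : ℕ∞ω) + 1) P.step := by simpa using P.contDiff_step
  exact (contDiff_succ_iff_deriv.1 h1).2.2

lemma hasCompactSupport_deriv_step : HasCompactSupport (deriv P.step) := by
  refine HasCompactSupport.intro (isCompact_Icc (a := 0) (b := P.T)) fun τ hτ => ?_
  by_contra h
  obtain ⟨h1, h2⟩ := P.lt_of_deriv_step_ne_zero h
  have h0 : 0 < P.Q * τ := P.T_pos.trans h1
  exact hτ ⟨(pos_of_mul_pos_right h0 P.Q_pos.le).le, h2.le⟩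

lemma exists_isBound : ∃ M, P.IsBound M := by
  obtain ⟨a0, h0⟩ := P.isBump_η.exists_bound
  obtain ⟨a1, h1⟩ := P.isBump_η.deriv.exists_bound
  obtain ⟨a2, h2⟩ := P.isBump_η.deriv.deriv.exists_bound
  obtain ⟨a3, h3⟩ := P.isBump_η.deriv.deriv.deriv.exists_bound
  obtain ⟨b0, k0⟩ := P.isBump_ζ.exists_bound
  obtain ⟨b1, k1⟩ := P.isBump_ζ.deriv.exists_bound
  obtain ⟨b2, k2⟩ := P.isBump_ζ.deriv.deriv.exists_bound
  obtain ⟨b3, k3⟩ := P.isBump_ζ.deriv.deriv.deriv.exists_bound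
  obtain ⟨c1, l1⟩ := P.contDiff_deriv_step.continuous.bounded_above_of_compact_support
    P.hasCompactSupport_deriv_step
  obtain ⟨c2, l2⟩ := (P.contDiff_deriv_step.continuous_deriv (by simp)).bounded_above_of_compact_support
    P.hasCompactSupport_deriv_step.deriv
  have n0 := (abs_nonneg _).trans (h0 0)
  have n1 := (abs_nonneg _).trans (h1 0)
  have n2 := (abs_nonneg _).trans (h2 0)
  have n3 := (abs_nonneg _).trans (h3 0)
  have m0 := (abs_nonneg _).trans (k0 0)
  have m1 := (abs_nonneg _).trans (k1 0)
  have m2 := (abs_nonneg _).trans (k2 0)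
  have m3 := (abs_nonneg _).trans (k3 0)
  have o1 := (norm_nonneg _).trans (l1 0)
  have o2 := (norm_nonneg _).trans (l2 0)
  refine ⟨1 + a0 + a1 + a2 + a3 + b0 + b1 + b2 + b3 + c1 + c2, by linarith,
    ⟨P.isBump_η, fun y => (h0 y).trans ?_, fun y => (h1 y).trans ?_⟩,
    ⟨P.isBump_η.deriv, fun y => (h1 y).trans ?_, fun y => (h2 y).trans ?_⟩,
    ⟨P.isBump_η.deriv.deriv, fun y => (h2 y).trans ?_, fun y => (h3 y).trans ?_⟩,
    ⟨P.isBump_ζ, fun y => (k0 y).trans ?_, fun y => (k1 y).trans ?_⟩,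
    ⟨P.isBump_ζ.deriv, fun y => (k1 y).trans ?_, fun y => (k2 y).trans ?_⟩,
    ⟨P.isBump_ζ.deriv.deriv, fun y => (k2 y).trans ?_, fun y => (k3 y).trans ?_⟩,
    fun y => (l1 y).trans ?_, fun y => (l2 y).trans ?_⟩ <;> linarith

variable {P}

lemma IsBound.abs_step_sub_le {M : ℝ} (hM : P.IsBound M) (τ τ' : ℝ) :
    |P.step τ - P.step τ'| ≤ M * |τ - τ'| :=
  Convex.norm_image_sub_le_of_norm_deriv_le (s := univ)
    (fun s _ => P.contDiff_step.differentiable (by simp) s) (fun s _ => hM.abs_deriv_step s)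
    convex_univ (mem_univ τ') (mem_univ τ)

lemma IsBound.abs_deriv_step_sub_le {M : ℝ} (hM : P.IsBound M) (τ τ' : ℝ) :
    |deriv P.step τ - deriv P.step τ'| ≤ M * |τ - τ'| :=
  Convex.norm_image_sub_le_of_norm_deriv_le (s := univ)
    (fun s _ => P.contDiff_deriv_step.differentiable (by simp) s)
    (fun s _ => hM.abs_deriv_deriv_step s) convex_univ (mem_univ τ') (mem_univ τ)

end Setup

/-! ### The blocks of the vector field: size and Lipschitz bounds -/

namespace Setup

variable {d : ℕ} (P : Setup d)

/-- A coordinate different from `j`. -/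
def aux (j : Fin d) : Fin d := ⟨if j.1 = 0 then 1 else 0, by have := P.two_le; split <;> omega⟩

lemma aux_ne (j : Fin d) : P.aux j ≠ j := by
  intro h
  have := congrArg Fin.val h
  simp only [aux] at this
  split at this <;> omega

/-- In a cell of generation `n`, the distance at time `t` between the `i`-th coordinates of the
center and of the moving cubes, in the unit of the cell. -/
def radius (n : ℕ) (i : Fin d) (t : ℝ) : ℝ :=
  1 / 4 - (1 / 4 - P.scale n) * P.step (P.Q ^ (n * d + i) * t)

/-- The speed at which the cubes of generation `n + 1` move in direction `j`. -/
def speed (n : ℕ) (j : Fin d) (t : ℝ) : ℝ :=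
  -((1 / 4 - P.scale n) * (P.Q ^ (n * d + j) * deriv P.step (P.Q ^ (n * d + j) * t)) / 2 ^ n)

/-- A product of functions of the coordinates, concentrated near the moving cubes. It is odd in the
coordinate `j`, with respect to the centers of the cells, if all `Φ i` are even. -/
def prodBump (b : Torus d) (n : ℕ) (j : Fin d) (Φ : Fin d → ℝ → ℝ) (t : ℝ) (x : Torus d) : ℝ :=
  ∏ i, pairBump (Φ i) (if i = j then -1 else 1) (P.scale n) (P.radius n i t)
    ((2 ^ n : ℕ) • (x i - b i))

/-- The vector field with components `speed * prodBump Φ` and `- speed * prodBump Ψ` in the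
directions `j` and `aux j`. -/
def term (b : Torus d) (n : ℕ) (j : Fin d) (Φ Ψ : Fin d → ℝ → ℝ) (t : ℝ) (x : Torus d) : Vec d :=
  P.speed n j t • (EuclideanSpace.single j (P.prodBump b n j Φ t x) -
    EuclideanSpace.single (P.aux j) (P.prodBump b n j Ψ t x))

/-- The profiles of the component in direction `j` of a block. -/
def profile₁ (j : Fin d) : Fin d → ℝ → ℝ :=
  Function.update (fun _ => P.η) (P.aux j) (deriv P.ζ)

/-- The profiles of the component in direction `aux j` of a block. -/
def profile₂ (j : Fin d) : Fin d → ℝ → ℝ :=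
  Function.update (Function.update (fun _ => P.η) (P.aux j) P.ζ) j (deriv P.η)

/-- The derivative of the `i`-th profile. -/
def derivAt (i : Fin d) (Φ : Fin d → ℝ → ℝ) : Fin d → ℝ → ℝ := Function.update Φ i (deriv (Φ i))

/-- The divergence-free field that translates the cubes of generation `n + 1` in direction `j`. -/
def block (b : Torus d) (n : ℕ) (j : Fin d) : ℝ → Torus d → Vec d :=
  P.term b n j (P.profile₁ j) (P.profile₂ j)

/-- The partial derivative of `block` in direction `i`. -/
def blockGrad (b : Torus d) (n : ℕ) (j i : Fin d) (t : ℝ) (x : Torus d) : Vec d :=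
  (2 ^ n / P.scale n) • P.term b n j (derivAt i (P.profile₁ j)) (derivAt i (P.profile₂ j)) t x

lemma isBump_profile₁ (j i : Fin d) : IsBump (P.profile₁ j i) := by
  by_cases h : i = P.aux j
  · subst h; simpa [profile₁] using P.isBump_ζ.deriv
  · simpa [profile₁, h] using P.isBump_η

lemma isBump_profile₂ (j i : Fin d) : IsBump (P.profile₂ j i) := by
  by_cases h' : i = j
  · subst h'; simpa [profile₂] using P.isBump_η.deriv
  by_cases h : i = P.aux j
  · subst h; simpa [profile₂, h'] using P.isBump_ζ
  · simpa [profile₂, h, h'] using P.isBump_η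

variable {P}

lemma IsBound.profile₁ {M : ℝ} (hM : P.IsBound M) (j i : Fin d) :
    IsProfile M (P.profile₁ j i) ∧ IsProfile M (deriv (P.profile₁ j i)) := by
  by_cases h : i = P.aux j
  · subst h; simpa [Setup.profile₁] using ⟨hM.ζ₁, hM.ζ₂⟩
  · simpa [Setup.profile₁, h] using ⟨hM.η₀, hM.η₁⟩

lemma IsBound.profile₂ {M : ℝ} (hM : P.IsBound M) (j i : Fin d) :
    IsProfile M (P.profile₂ j i) ∧ IsProfile M (deriv (P.profile₂ j i)) := by
  by_cases h' : i = j
  · subst h'; simpa [Setup.profile₂] using ⟨hM.η₁, hM.η₂⟩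
  by_cases h : i = P.aux j
  · subst h; simpa [Setup.profile₂, h'] using ⟨hM.ζ₀, hM.ζ₁⟩
  · simpa [Setup.profile₂, h, h'] using ⟨hM.η₀, hM.η₁⟩

lemma isProfile_derivAt {M : ℝ} {Φ : Fin d → ℝ → ℝ}
    (h : ∀ i, IsProfile M (Φ i) ∧ IsProfile M (deriv (Φ i))) (i i' : Fin d) :
    IsProfile M (derivAt i Φ i') := by
  by_cases hi : i' = i
  · subst hi; simpa [derivAt] using (h i').2
  · simpa [derivAt, hi] using (h i').1

variable (P)

lemma abs_sign {j i : Fin d} : |(if i = j then (-1 : ℝ) else 1)| = 1 := by split <;> simp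

lemma nsmul_sub_add_single (N : ℕ) (x b : Torus d) (i : Fin d) (s : ℝ) :
    N • ((x + Pi.single i (s : UnitAddCircle) : Torus d) i - b i) =
      N • (x i - b i) + (((N : ℝ) * s : ℝ) : UnitAddCircle) := by
  have : (((N : ℝ) * s : ℝ) : UnitAddCircle) = N • (s : UnitAddCircle) := by
    rw [← nsmul_eq_mul, AddCircle.coe_nsmul]
  rw [this, ← nsmul_add]
  congr 1
  simp only [Pi.add_apply, Pi.single_eq_same]
  abel

lemma hasDerivAt_prodBump (b : Torus d) (n : ℕ) (j : Fin d) {Φ : Fin d → ℝ → ℝ}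
    (hΦ : ∀ i, IsBump (Φ i)) (t : ℝ) (i : Fin d) (x : Torus d) :
    HasDerivAt (fun s : ℝ => P.prodBump b n j Φ t (x + Pi.single i (s : UnitAddCircle)))
      (2 ^ n / P.scale n * P.prodBump b n j (derivAt i Φ) t x) 0 := by
  have h1 := hasDerivAt_pairBump (hΦ i) (P.scale_pos n) (P.scale_lt n)
    (if i = j then (-1 : ℝ) else 1) (P.radius n i t) ((2 ^ n : ℕ) : ℝ) ((2 ^ n : ℕ) • (x i - b i))
  have h2 := h1.mul_const (∏ i' ∈ Finset.univ.erase i, pairBump (Φ i') (if i' = j then -1 else 1)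
    (P.scale n) (P.radius n i' t) ((2 ^ n : ℕ) • (x i' - b i')))
  refine (h2.congr_deriv ?_).congr_of_eventuallyEq (.of_forall fun s => ?_)
  · rw [prodBump, ← Finset.mul_prod_erase Finset.univ _ (Finset.mem_univ i), ← mul_assoc]
    congr 1
    · simp [derivAt]
    · refine Finset.prod_congr rfl fun i' hi' => ?_
      rw [derivAt, Function.update_of_ne (Finset.ne_of_mem_erase hi')]
  · simp only [prodBump]
    rw [← Finset.mul_prod_erase Finset.univ _ (Finset.mem_univ i), nsmul_sub_add_single]
    congr 1
    refine Finset.prod_congr rfl fun k hk => ?_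
    simp [Finset.ne_of_mem_erase hk]

/-- A bound for the speed of all cubes in generation `n`. -/
def rate (n : ℕ) : ℝ := P.Q ^ ((n + 1) * d)

lemma one_le_rate (n : ℕ) : 1 ≤ P.rate n := one_le_pow₀ P.one_lt_Q.le

lemma pow_le_rate (n : ℕ) (i : Fin d) : P.Q ^ (n * d + i) ≤ P.rate n := by
  refine pow_le_pow_right₀ P.one_lt_Q.le ?_
  have := i.2
  rw [add_mul, one_mul]
  omega

/-- The constant in the estimates of the blocks. -/
def blockConst (d : ℕ) (M : ℝ) : ℝ := 2 * M * (2 * M) ^ d * (1 + 2 * d * M * (1 + M))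

variable {P} {M : ℝ}

lemma IsBound.abs_radius_sub_le (hM : P.IsBound M) (n : ℕ) (i : Fin d) (t t' : ℝ) :
    |P.radius n i t - P.radius n i t'| ≤ M * P.rate n * |t - t'| := by
  have h1 := hM.abs_step_sub_le (P.Q ^ (n * d + i) * t) (P.Q ^ (n * d + i) * t')
  have h2 := P.pow_le_rate n i
  have hs := P.scale_pos n
  have hs' := P.scale_lt n
  have hQ := pow_pos P.Q_pos (n * d + i)
  have e : P.radius n i t - P.radius n i t' = (1 / 4 - P.scale n) *
      -(P.step (P.Q ^ (n * d + i) * t) - P.step (P.Q ^ (n * d + i) * t')) := by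
    simp only [radius]; ring
  rw [← mul_sub, abs_mul, abs_of_pos hQ] at h1
  have hM0 : 0 ≤ M := zero_le_one.trans hM.one_le
  rw [e, abs_mul, abs_neg, abs_of_pos (by linarith)]
  calc _ ≤ 1 * (M * (P.Q ^ (n * d + i) * |t - t'|)) := by gcongr; linarith
    _ ≤ 1 * (M * (P.rate n * |t - t'|)) := by gcongr
    _ = _ := by ring

lemma IsBound.abs_speed_le (hM : P.IsBound M) (n : ℕ) (j : Fin d) (t : ℝ) :
    |P.speed n j t| ≤ M * P.rate n / 2 ^ n := by
  have h1 := hM.abs_deriv_step (P.Q ^ (n * d + j) * t)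
  have h2 := P.pow_le_rate n j
  have hs := P.scale_pos n
  have hs' := P.scale_lt n
  have hQ := pow_pos P.Q_pos (n * d + j)
  have hM0 : 0 ≤ M := zero_le_one.trans hM.one_le
  rw [speed, abs_neg, abs_div, abs_mul, abs_mul, abs_of_pos hQ,
    abs_of_pos (show (0 : ℝ) < 2 ^ n by positivity), abs_of_pos (show 0 < 1 / 4 - P.scale n by linarith)]
  refine div_le_div_of_nonneg_right ?_ (by positivity)
  have hR : 0 ≤ P.rate n := hQ.le.trans h2
  calc _ ≤ 1 * (P.rate n * M) := by gcongr; linarith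
    _ = _ := by ring

lemma IsBound.abs_speed_sub_le (hM : P.IsBound M) (n : ℕ) (j : Fin d) (t t' : ℝ) :
    |P.speed n j t - P.speed n j t'| ≤ M * P.rate n ^ 2 / 2 ^ n * |t - t'| := by
  have h1 := hM.abs_deriv_step_sub_le (P.Q ^ (n * d + j) * t) (P.Q ^ (n * d + j) * t')
  have h2 := P.pow_le_rate n j
  have hs := P.scale_pos n
  have hs' := P.scale_lt n
  have hQ := pow_pos P.Q_pos (n * d + j)
  have hM0 : 0 ≤ M := zero_le_one.trans hM.one_le
  have e : P.speed n j t - P.speed n j t' = -((1 / 4 - P.scale n) * (P.Q ^ (n * d + j) *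
      (deriv P.step (P.Q ^ (n * d + j) * t) - deriv P.step (P.Q ^ (n * d + j) * t'))) / 2 ^ n) := by
    simp only [speed]; ring
  rw [← mul_sub, abs_mul, abs_of_pos hQ] at h1
  rw [e, abs_neg, abs_div, abs_mul, abs_mul, abs_of_pos hQ,
    abs_of_pos (show (0 : ℝ) < 2 ^ n by positivity), abs_of_pos (show 0 < 1 / 4 - P.scale n by linarith),
    div_mul_eq_mul_div]
  refine div_le_div_of_nonneg_right ?_ (by positivity)
  have hR : 0 ≤ P.rate n := hQ.le.trans h2
  calc _ ≤ 1 * (P.rate n * (M * (P.rate n * |t - t'|))) := by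
        gcongr
        · linarith
        · exact h1.trans (by gcongr)
    _ = _ := by ring

lemma abs_prodBump_le (b : Torus d) (n : ℕ) (j : Fin d)
    {Φ : Fin d → ℝ → ℝ} (hΦ : ∀ i, IsProfile M (Φ i)) (t : ℝ) (x : Torus d) :
    |P.prodBump b n j Φ t x| ≤ (2 * M) ^ d := by
  rw [prodBump, Finset.abs_prod]
  exact (Finset.prod_le_prod (fun i _ => abs_nonneg _)
    fun i _ => abs_pairBump_le (hΦ i) abs_sign _ _ _).trans (by simp)

lemma norm_nsmul_sub_le (N : ℕ) (x x' b : Torus d) (i : Fin d) :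
    ‖N • (x i - b i) - N • (x' i - b i)‖ ≤ N * ‖x - x'‖ := by
  rw [← nsmul_sub, sub_sub_sub_cancel_right]
  refine norm_nsmul_le.trans ?_
  gcongr
  exact norm_le_pi_norm (x - x') i

lemma IsBound.abs_prodBump_sub_le (hM : P.IsBound M) (b : Torus d) (n : ℕ) (j : Fin d)
    {Φ : Fin d → ℝ → ℝ} (hΦ : ∀ i, IsProfile M (Φ i)) {t t' : ℝ} {x x' : Torus d} {δ : ℝ}
    (ht : |t - t'| ≤ δ) (hx : ‖x - x'‖ ≤ δ) :
    |P.prodBump b n j Φ t x - P.prodBump b n j Φ t' x'| ≤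
      d * (2 * M) ^ d * (2 * M / P.scale n * ((2 ^ n + M * P.rate n) * δ)) := by
  have hM1 := hM.one_le
  have hs := P.scale_pos n
  have hR := P.one_le_rate n
  have hδ : 0 ≤ δ := (abs_nonneg _).trans ht
  have := abs_prod_sub_prod_le Finset.univ (B := 2 * M)
    (δ := 2 * M / P.scale n * ((2 ^ n + M * P.rate n) * δ)) (by linarith) (by positivity)
    (fun i => abs_pairBump_le (hΦ i) (abs_sign (j := j) (i := i)) (P.scale n) (P.radius n i t)
      ((2 ^ n : ℕ) • (x i - b i)))
    (fun i => abs_pairBump_le (hΦ i) (abs_sign (j := j) (i := i)) (P.scale n) (P.radius n i t')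
      ((2 ^ n : ℕ) • (x' i - b i)))
    (fun i => by
      refine (abs_pairBump_sub_le (hΦ i) (abs_sign (j := j) (i := i)) (P.scale_pos n)
        (P.scale_lt n) _ _ _ _).trans ?_
      gcongr
      rw [add_mul]
      refine add_le_add ((norm_nsmul_sub_le _ x x' b i).trans ?_)
        ((hM.abs_radius_sub_le n i t t').trans ?_)
      · push_cast; gcongr
      · gcongr)
  simpa [prodBump] using this

lemma norm_single_sub_single_le (j k : Fin d) (a c : ℝ) :
    ‖(EuclideanSpace.single j a - EuclideanSpace.single k c : Vec d)‖ ≤ |a| + |c| := by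
  refine (norm_sub_le _ _).trans ?_
  simp

lemma IsBound.norm_term_le (hM : P.IsBound M) (b : Torus d) (n : ℕ) (j : Fin d)
    {Φ Ψ : Fin d → ℝ → ℝ} (hΦ : ∀ i, IsProfile M (Φ i)) (hΨ : ∀ i, IsProfile M (Ψ i))
    (t : ℝ) (x : Torus d) :
    ‖P.term b n j Φ Ψ t x‖ ≤ blockConst d M * P.rate n / 2 ^ n := by
  have hM1 := hM.one_le
  have hR := P.one_le_rate n
  rw [term, norm_smul, Real.norm_eq_abs]
  calc _ ≤ M * P.rate n / 2 ^ n * ((2 * M) ^ d + (2 * M) ^ d) := by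
        gcongr
        · exact hM.abs_speed_le n j t
        · exact (norm_single_sub_single_le _ _ _ _).trans
            (add_le_add (abs_prodBump_le b n j hΦ t x) (abs_prodBump_le b n j hΨ t x))
    _ = 2 * M * (2 * M) ^ d * 1 * P.rate n / 2 ^ n := by ring
    _ ≤ _ := by
        unfold blockConst
        gcongr
        have : 0 ≤ 2 * d * M * (1 + M) := by positivity
        linarith

/-- A derivative of the product of bumps costs `2 ^ n / scale` in space and `rate / scale` in time;
a time derivative of the speed costs `rate`. The speed itself is of order `rate / 2 ^ n`, which
cancels the `2 ^ n` and leaves `rate ^ 2 / scale`. -/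
lemma IsBound.norm_term_sub_le (hM : P.IsBound M) (b : Torus d) (n : ℕ) (j : Fin d)
    {Φ Ψ : Fin d → ℝ → ℝ} (hΦ : ∀ i, IsProfile M (Φ i)) (hΨ : ∀ i, IsProfile M (Ψ i))
    {t t' : ℝ} {x x' : Torus d} {δ : ℝ} (ht : |t - t'| ≤ δ) (hx : ‖x - x'‖ ≤ δ) :
    ‖P.term b n j Φ Ψ t x - P.term b n j Φ Ψ t' x'‖ ≤
      blockConst d M * P.rate n ^ 2 / P.scale n * δ := by
  have hM1 := hM.one_le
  have hR := P.one_le_rate n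
  have hs := P.scale_pos n
  have hs1 := P.scale_le n
  have hδ : 0 ≤ δ := (abs_nonneg _).trans ht
  have hN : (1 : ℝ) ≤ 2 ^ n := one_le_pow₀ one_le_two
  set v := (EuclideanSpace.single j (P.prodBump b n j Φ t x) -
    EuclideanSpace.single (P.aux j) (P.prodBump b n j Ψ t x) : Vec d) with hv
  set v' := (EuclideanSpace.single j (P.prodBump b n j Φ t' x') -
    EuclideanSpace.single (P.aux j) (P.prodBump b n j Ψ t' x') : Vec d) with hv'
  have e : P.term b n j Φ Ψ t x - P.term b n j Φ Ψ t' x' =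
      (P.speed n j t - P.speed n j t') • v + P.speed n j t' • (v - v') := by
    rw [term, term, ← hv, ← hv']; module
  have hvv : v - v' =
      (EuclideanSpace.single j (P.prodBump b n j Φ t x - P.prodBump b n j Φ t' x') -
      EuclideanSpace.single (P.aux j) (P.prodBump b n j Ψ t x - P.prodBump b n j Ψ t' x') :
        Vec d) := by
    ext i
    simp only [hv, hv', PiLp.sub_apply, PiLp.single_apply]
    split_ifs <;> ring
  have h1 : ‖v‖ ≤ (2 * M) ^ d + (2 * M) ^ d := (norm_single_sub_single_le _ _ _ _).trans
    (add_le_add (abs_prodBump_le b n j hΦ t x) (abs_prodBump_le b n j hΨ t x))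
  have h2 : ‖v - v'‖ ≤ 2 * (d * (2 * M) ^ d *
      (2 * M / P.scale n * ((2 ^ n + M * P.rate n) * δ))) := by
    rw [hvv, two_mul]
    exact (norm_single_sub_single_le _ _ _ _).trans
      (add_le_add (hM.abs_prodBump_sub_le b n j hΦ ht hx) (hM.abs_prodBump_sub_le b n j hΨ ht hx))
  have h3 : |P.speed n j t - P.speed n j t'| ≤ M * P.rate n ^ 2 / P.scale n * δ := by
    refine (hM.abs_speed_sub_le n j t t').trans ?_
    gcongr
    linarith
  have h4 : (2 ^ n + M * P.rate n) ≤ 2 ^ n * ((1 + M) * P.rate n) := by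
    have : 1 ≤ P.rate n := hR
    nlinarith [mul_nonneg (sub_nonneg.2 hN) (show 0 ≤ M * P.rate n by positivity),
      mul_nonneg (sub_nonneg.2 hR) (show (0 : ℝ) ≤ 2 ^ n by positivity)]
  rw [e]
  refine (norm_add_le _ _).trans ?_
  rw [norm_smul, norm_smul, Real.norm_eq_abs, Real.norm_eq_abs]
  calc _ ≤ M * P.rate n ^ 2 / P.scale n * δ * ((2 * M) ^ d + (2 * M) ^ d) +
        M * P.rate n / 2 ^ n * (2 * (d * (2 * M) ^ d *
          (2 * M / P.scale n * ((2 ^ n * ((1 + M) * P.rate n)) * δ)))) := by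
        gcongr
        · exact hM.abs_speed_le n j t'
        · exact h2.trans (by gcongr)
    _ = _ := by
        unfold blockConst
        field_simp
        ring

end Setup

/-! ### The blocks: gradient, divergence and support -/

namespace Setup

variable {d : ℕ} {P : Setup d} {M : ℝ}

lemma IsBound.continuous_term (hM : P.IsBound M) (b : Torus d) (n : ℕ) (j : Fin d)
    {Φ Ψ : Fin d → ℝ → ℝ} (hΦ : ∀ i, IsProfile M (Φ i)) (hΨ : ∀ i, IsProfile M (Ψ i)) (t : ℝ) :
    Continuous (P.term b n j Φ Ψ t) := by
  have hM1 := hM.one_le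
  have hs := P.scale_pos n
  refine LipschitzWith.continuous (K := (blockConst d M * P.rate n ^ 2 / P.scale n).toNNReal)
    (LipschitzWith.of_dist_le_mul fun x y => ?_)
  rw [dist_eq_norm, dist_eq_norm, Real.coe_toNNReal _ (by unfold blockConst; positivity)]
  exact hM.norm_term_sub_le b n j hΦ hΨ (by simp) le_rfl

lemma IsBound.continuous_block (hM : P.IsBound M) (b : Torus d) (n : ℕ) (j : Fin d) (t : ℝ) :
    Continuous (P.block b n j t) :=
  hM.continuous_term b n j (fun i => (hM.profile₁ j i).1) (fun i => (hM.profile₂ j i).1) t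

lemma IsBound.continuous_blockGrad (hM : P.IsBound M) (b : Torus d) (n : ℕ) (j i : Fin d) (t : ℝ) :
    Continuous (P.blockGrad b n j i t) :=
  (hM.continuous_term b n j (isProfile_derivAt (hM.profile₁ j) i)
    (isProfile_derivAt (hM.profile₂ j) i) t).const_smul (2 ^ n / P.scale n)

lemma single_eq_smul (j : Fin d) (a : ℝ) :
    (EuclideanSpace.single j a : Vec d) = a • EuclideanSpace.single j 1 := by
  ext i
  simp [PiLp.single_apply]

lemma IsBound.hasGradient_block (hM : P.IsBound M) (b : Torus d) (n : ℕ) (j : Fin d) (t : ℝ) :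
    HasGradient (P.block b n j t) (fun i => P.blockGrad b n j i t) where
  continuous := hM.continuous_block b n j t
  continuous_grad i := hM.continuous_blockGrad b n j i t
  hasDerivAt i x := by
    have h1 := (P.hasDerivAt_prodBump b n j (P.isBump_profile₁ j) t i x).smul_const
      (EuclideanSpace.single j 1 : Vec d)
    have h2 := (P.hasDerivAt_prodBump b n j (P.isBump_profile₂ j) t i x).smul_const
      (EuclideanSpace.single (P.aux j) 1 : Vec d)
    have h3 := (h1.sub h2).const_smul (P.speed n j t)
    refine (h3.congr_deriv ?_).congr_of_eventuallyEq (.of_forall fun s => ?_)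
    · rw [blockGrad, term, single_eq_smul j (P.prodBump b n j _ t x),
        single_eq_smul (P.aux j) (P.prodBump b n j _ t x)]
      module
    · simp only [block, term, Pi.smul_apply, Pi.sub_apply]
      rw [single_eq_smul j (P.prodBump b n j _ t _),
        single_eq_smul (P.aux j) (P.prodBump b n j _ t _)]

variable (P) in
-- The two components of a block are, up to a factor, the derivatives in directions `aux j` and `-j`
-- of one stream function, a product of `η` in all coordinates except `ζ` in coordinate `aux j`. The
-- identity is the symmetry of its mixed second derivative, and it makes the divergence vanish.
lemma derivAt_profile (j : Fin d) :
    derivAt j (P.profile₁ j) = derivAt (P.aux j) (P.profile₂ j) := by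
  have hne := P.aux_ne j
  funext i
  by_cases h : i = j
  · subst h
    simp [derivAt, profile₁, profile₂, hne, hne.symm]
  by_cases h' : i = P.aux j
  · subst h'
    simp [derivAt, profile₁, profile₂, hne]
  · simp [derivAt, profile₁, profile₂, h, h']

variable (P) in
lemma sum_blockGrad (b : Torus d) (n : ℕ) (j : Fin d) (t : ℝ) (x : Torus d) :
    ∑ i, P.blockGrad b n j i t x i = 0 := by
  simp only [blockGrad, term, PiLp.smul_apply, PiLp.sub_apply, PiLp.single_apply, smul_eq_mul,
    mul_sub, mul_ite, mul_zero, Finset.sum_sub_distrib, Finset.sum_ite_eq',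
    Finset.mem_univ, if_true, P.derivAt_profile, sub_self]

lemma IsBound.norm_block_le (hM : P.IsBound M) (b : Torus d) (n : ℕ) (j : Fin d) (t : ℝ)
    (x : Torus d) : ‖P.block b n j t x‖ ≤ blockConst d M * P.rate n / 2 ^ n :=
  hM.norm_term_le b n j (fun i => (hM.profile₁ j i).1) (fun i => (hM.profile₂ j i).1) t x

lemma IsBound.norm_block_sub_le (hM : P.IsBound M) (b : Torus d) (n : ℕ) (j : Fin d)
    {t t' : ℝ} {x x' : Torus d} {δ : ℝ} (ht : |t - t'| ≤ δ) (hx : ‖x - x'‖ ≤ δ) :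
    ‖P.block b n j t x - P.block b n j t' x'‖ ≤ blockConst d M * P.rate n ^ 2 / P.scale n * δ :=
  hM.norm_term_sub_le b n j (fun i => (hM.profile₁ j i).1) (fun i => (hM.profile₂ j i).1) ht hx

lemma IsBound.norm_blockGrad_le (hM : P.IsBound M) (b : Torus d) (n : ℕ) (j i : Fin d) (t : ℝ)
    (x : Torus d) : ‖P.blockGrad b n j i t x‖ ≤ blockConst d M * P.rate n / P.scale n := by
  have hs := P.scale_pos n
  rw [blockGrad, norm_smul, Real.norm_of_nonneg (by positivity)]
  have := hM.norm_term_le b n j (isProfile_derivAt (hM.profile₁ j) i)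
    (isProfile_derivAt (hM.profile₂ j) i) t x
  calc _ ≤ 2 ^ n / P.scale n * (blockConst d M * P.rate n / 2 ^ n) := by gcongr
    _ = _ := by field_simp

lemma IsBound.norm_blockGrad_sub_le (hM : P.IsBound M) (b : Torus d) (n : ℕ) (j i : Fin d)
    (t t' : ℝ) (x : Torus d) :
    ‖P.blockGrad b n j i t x - P.blockGrad b n j i t' x‖ ≤
      2 ^ n / P.scale n * (blockConst d M * P.rate n ^ 2 / P.scale n * |t - t'|) := by
  have hs := P.scale_pos n
  rw [blockGrad, blockGrad, ← smul_sub, norm_smul, Real.norm_of_nonneg (by positivity)]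
  gcongr
  exact hM.norm_term_sub_le b n j (isProfile_derivAt (hM.profile₁ j) i)
    (isProfile_derivAt (hM.profile₂ j) i) le_rfl (by simp)

variable (P) in
/-- The region, in generation `n`, of the moving cubes at time `t`. -/
def region (b : Torus d) (n : ℕ) (t : ℝ) : Set (Torus d) :=
  {x | ∀ i, (2 ^ n : ℕ) • (x i - b i) ∈
    Metric.closedBall ((1 / 2 + P.radius n i t : ℝ) : UnitAddCircle) (P.scale n) ∪
    Metric.closedBall ((1 / 2 - P.radius n i t : ℝ) : UnitAddCircle) (P.scale n)}

variable (P) in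
lemma volume_region_le (b : Torus d) (n : ℕ) (t : ℝ) :
    volume (P.region b n t) ≤ ENNReal.ofReal (4 * P.scale n) ^ d :=
  volume_forall_nsmul_sub_mem_le (by positivity) b _
    (fun i => Metric.isClosed_closedBall.measurableSet.union Metric.isClosed_closedBall.measurableSet)
    fun i => volume_union_closedBall_le (P.scale_pos n) _ _

variable (P) in
lemma prodBump_eq_zero (b : Torus d) (n : ℕ) (j : Fin d) {Φ : Fin d → ℝ → ℝ}
    (hΦ : ∀ i, IsBump (Φ i)) {t : ℝ} {x : Torus d} (hx : x ∉ P.region b n t) :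
    P.prodBump b n j Φ t x = 0 := by
  simp only [region, mem_ofPred_eq, not_forall, mem_union, not_or, Metric.mem_closedBall, not_le,
    dist_eq_norm] at hx
  obtain ⟨i, h1, h2⟩ := hx
  exact Finset.prod_eq_zero (Finset.mem_univ i)
    (pairBump_eq_zero (hΦ i) (P.scale_pos n) _ _ h1.le h2.le)

variable (P) in
lemma term_eq_zero (b : Torus d) (n : ℕ) (j : Fin d) {Φ Ψ : Fin d → ℝ → ℝ}
    (hΦ : ∀ i, IsBump (Φ i)) (hΨ : ∀ i, IsBump (Ψ i)) {t : ℝ} {x : Torus d}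
    (hx : x ∉ P.region b n t) : P.term b n j Φ Ψ t x = 0 := by
  rw [term, P.prodBump_eq_zero b n j hΦ hx, P.prodBump_eq_zero b n j hΨ hx,
    single_eq_smul j 0, single_eq_smul (P.aux j) 0]
  simp

/-- The gradient is of order `rate / scale` and lives on the region of the moving cubes, whose
measure is at most `(4 * scale) ^ d`. -/
lemma IsBound.eLpNorm_blockGrad_le (hM : P.IsBound M) (b : Torus d) (n : ℕ) (j i : Fin d) (t : ℝ)
    {p : ℝ} (hp : 1 ≤ p) :
    eLpNorm (P.blockGrad b n j i t) (ENNReal.ofReal p) ≤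
      ENNReal.ofReal ((4 * P.scale n) ^ (d / p) * (blockConst d M * P.rate n / P.scale n)) := by
  have hs := P.scale_pos n
  have hsupp : Function.support (P.blockGrad b n j i t) ⊆ P.region b n t := by
    intro x hx
    by_contra hn
    refine hx ?_
    rw [blockGrad, P.term_eq_zero b n j
      (fun i' => (isProfile_derivAt (hM.profile₁ j) i i').toIsBump)
      (fun i' => (isProfile_derivAt (hM.profile₂ j) i i').toIsBump) hn, smul_zero]
  refine (eLpNorm_le_of_support (hM.norm_blockGrad_le b n j i t) hsupp _).trans ?_
  rw [ENNReal.ofReal_mul (by positivity), ENNReal.toReal_ofReal (by linarith)]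
  gcongr
  calc volume (P.region b n t) ^ p⁻¹ ≤ (ENNReal.ofReal (4 * P.scale n) ^ d) ^ p⁻¹ := by
        gcongr; exact P.volume_region_le b n t
    _ = _ := by
        rw [← ENNReal.rpow_natCast, ← ENNReal.rpow_mul, ← div_eq_mul_inv,
          ENNReal.ofReal_rpow_of_pos (by positivity)]

variable (P)

/-! ### The sum of the blocks: Sobolev and Hölder continuity -/

/-- The sum of all blocks, with the origin of the dyadic cells at `b`. -/
def field (b : Torus d) (t : ℝ) (x : Torus d) : Vec d :=
  ∑' m : ℕ × Fin d, P.block b m.1 m.2 t x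

/-- The partial derivative of `field` in direction `i`. -/
def fieldGrad (b : Torus d) (t : ℝ) (i : Fin d) (x : Torus d) : Vec d :=
  ∑' m : ℕ × Fin d, P.blockGrad b m.1 m.2 i t x

lemma index_injective {m m' : ℕ × Fin d} (h : m.1 * d + m.2 = m'.1 * d + (m'.2 : ℕ)) : m = m' := by
  have hd : 0 < d := m.2.pos
  have h2 := congrArg (· % d) h
  simp only [Nat.mul_add_mod_self_right, Nat.mod_eq_of_lt m.2.2, Nat.mod_eq_of_lt m'.2.2] at h2
  exact Prod.ext (Nat.eq_of_mul_eq_mul_right hd (by omega)) (Fin.ext h2)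

/-- The time windows are disjoint and `n * d + j` determines `(n, j)`. If no block moves at time
`t`, any index serves. -/
lemma exists_speed_eq_zero (hd : 0 < d) (t : ℝ) :
    ∃ m : ℕ × Fin d, ∀ m' ≠ m, P.speed m'.1 m'.2 t = 0 := by
  by_cases h : ∃ m : ℕ × Fin d, deriv P.step (P.Q ^ (m.1 * d + m.2) * t) ≠ 0
  · obtain ⟨m, hm⟩ := h
    refine ⟨m, fun m' hm' => ?_⟩
    rw [speed, P.deriv_step_eq_zero_of_ne hm fun h => hm' (index_injective h)]
    simp
  · push Not at h
    refine ⟨(0, ⟨0, hd⟩), fun m' _ => ?_⟩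
    rw [speed, h m']
    simp

lemma exists_term_eq_zero (t : ℝ) :
    ∃ m : ℕ × Fin d, ∀ m' ≠ m, ∀ (b : Torus d) (Φ Ψ : Fin d → ℝ → ℝ),
      P.term b m'.1 m'.2 Φ Ψ t = 0 := by
  obtain ⟨m, hm⟩ := P.exists_speed_eq_zero (by have := P.two_le; omega) t
  refine ⟨m, fun m' hm' b Φ Ψ => ?_⟩
  funext x
  simp [term, hm m' hm']

lemma exists_field_eq (t : ℝ) :
    ∃ m : ℕ × Fin d, ∀ b, P.field b t = P.block b m.1 m.2 t ∧
      P.fieldGrad b t = fun i => P.blockGrad b m.1 m.2 i t := by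
  obtain ⟨m, hm⟩ := P.exists_term_eq_zero t
  refine ⟨m, fun b => ⟨?_, ?_⟩⟩
  · funext x
    exact tsum_eq_single m fun m' hm' => by rw [block, hm m' hm']; rfl
  · funext i x
    exact tsum_eq_single m fun m' hm' => by rw [blockGrad, hm m' hm']; simp

lemma hasGradient_field (b : Torus d) (t : ℝ) : HasGradient (P.field b t) (P.fieldGrad b t) := by
  obtain ⟨M, hM⟩ := P.exists_isBound
  obtain ⟨m, hm⟩ := P.exists_field_eq t
  rw [(hm b).1, (hm b).2]
  exact hM.hasGradient_block b m.1 m.2 t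

lemma sum_fieldGrad (b : Torus d) (t : ℝ) (x : Torus d) : ∑ i, P.fieldGrad b t i x i = 0 := by
  obtain ⟨m, hm⟩ := P.exists_field_eq t
  rw [(hm b).2]
  exact P.sum_blockGrad b m.1 m.2 t x

lemma tendsto_fst_cofinite : Tendsto (Prod.fst : ℕ × Fin d → ℕ) cofinite atTop := by
  rw [← Nat.cofinite_eq_atTop, tendsto_def]
  intro s hs
  rw [mem_cofinite] at hs ⊢
  rw [← preimage_compl]
  have : Prod.fst ⁻¹' sᶜ = sᶜ ×ˢ (univ : Set (Fin d)) := by ext; simp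
  rw [this]
  exact hs.prod finite_univ

lemma eventually_eLpNorm_le {p : ℝ≥0∞} {V : ℕ × Fin d → ℝ → Torus d → Vec d} {f : ℕ → ℝ}
    (hf : Tendsto f atTop (𝓝 0)) (hV : ∀ m t, eLpNorm (V m t) p ≤ ENNReal.ofReal (f m.1))
    (ε : ℝ≥0∞) (hε : 0 < ε) : ∀ᶠ m in cofinite, ∀ t, eLpNorm (V m t) p ≤ ε := by
  have h1 : Tendsto (fun n => ENNReal.ofReal (f n)) atTop (𝓝 0) := by
    simpa using ENNReal.tendsto_ofReal hf
  have h2 := h1.comp (tendsto_fst_cofinite (d := d))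
  filter_upwards [ENNReal.tendsto_nhds_zero.1 h2 ε hε] with m hm t
  exact (hV m t).trans hm

lemma tendsto_eLpNorm_of_le {p : ℝ≥0∞} {V : ℝ → Torus d → Vec d} {L : ℝ}
    (hV : ∀ s t x, ‖V s x - V t x‖ ≤ L * |s - t|) (t : ℝ) :
    Tendsto (fun s => eLpNorm (V s - V t) p) (𝓝 t) (𝓝 0) := by
  have h1 : Tendsto (fun s => ENNReal.ofReal (L * |s - t|)) (𝓝 t) (𝓝 0) := by
    have : Continuous fun s => ENNReal.ofReal (L * |s - t|) :=
      ENNReal.continuous_ofReal.comp (by fun_prop)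
    simpa using this.tendsto t
  refine tendsto_of_tendsto_of_tendsto_of_le_of_le tendsto_const_nhds h1 (fun _ => zero_le)
    fun s => ?_
  refine (eLpNorm_le_of_ae_bound (.of_forall fun x => hV s t x)).trans ?_
  rw [volume_torus_univ, ENNReal.one_rpow, one_mul]

lemma eLpNorm_le_ofReal {p : ℝ≥0∞} {f : Torus d → Vec d} {C : ℝ} (h : ∀ x, ‖f x‖ ≤ C) :
    eLpNorm f p ≤ ENNReal.ofReal C :=
  (eLpNorm_le_of_ae_bound (.of_forall h)).trans
    (by rw [volume_torus_univ, ENNReal.one_rpow, one_mul])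

lemma tendsto_eLpNorm_field_sub {p : ℝ≥0∞} (hp : 1 ≤ p)
    (h : Tendsto (fun n => P.rate n / 2 ^ n) atTop (𝓝 0)) (b : Torus d) (t : ℝ) :
    Tendsto (fun s => eLpNorm (P.field b s - P.field b t) p) (𝓝 t) (𝓝 0) := by
  obtain ⟨M, hM⟩ := P.exists_isBound
  refine tendsto_eLpNorm_tsum_sub (V := fun m : ℕ × Fin d => P.block b m.1 m.2) hp
    (fun m t => (integrable_of_continuous (hM.continuous_block b m.1 m.2 t)).aestronglyMeasurable)
    (fun t => ?_) (eventually_eLpNorm_le (f := fun n => blockConst d M * (P.rate n / 2 ^ n))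
      (by simpa using h.const_mul (blockConst d M)) fun m t => ?_) (fun m t => ?_) t
  · obtain ⟨m, hm⟩ := P.exists_term_eq_zero t
    exact ⟨m, fun m' hm' => hm m' hm' b _ _⟩
  · exact eLpNorm_le_ofReal fun x => (hM.norm_block_le b m.1 m.2 t x).trans_eq (by ring)
  · exact tendsto_eLpNorm_of_le
      (fun s t x => hM.norm_block_sub_le b m.1 m.2 (x := x) (x' := x) le_rfl (by simp)) t

/-- The sequence in `h` bounds, up to a constant, the `L^p` norms of the gradients of the blocks at
all times. Its decay gives continuity at `t = 0`, where infinitely many windows accumulate. -/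
lemma tendsto_eLpNorm_fieldGrad_sub {p : ℝ} (hp : 1 ≤ p)
    (h : Tendsto (fun n => P.rate n * P.scale n ^ (d / p - 1)) atTop (𝓝 0)) (b : Torus d)
    (t : ℝ) (i : Fin d) :
    Tendsto (fun s => eLpNorm (P.fieldGrad b s i - P.fieldGrad b t i) (ENNReal.ofReal p))
      (𝓝 t) (𝓝 0) := by
  obtain ⟨M, hM⟩ := P.exists_isBound
  refine tendsto_eLpNorm_tsum_sub (V := fun m : ℕ × Fin d => P.blockGrad b m.1 m.2 i)
    (by simpa using hp)
    (fun m t => (integrable_of_continuous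
      (hM.continuous_blockGrad b m.1 m.2 i t)).aestronglyMeasurable)
    (fun t => ?_) (eventually_eLpNorm_le
      (f := fun n => (4 : ℝ) ^ (d / p) * blockConst d M * (P.rate n * P.scale n ^ (d / p - 1)))
      (by simpa using h.const_mul ((4 : ℝ) ^ (d / p) * blockConst d M)) fun m t => ?_)
    (fun m t => ?_) t
  · obtain ⟨m, hm⟩ := P.exists_term_eq_zero t
    refine ⟨m, fun m' hm' => ?_⟩
    funext x
    rw [blockGrad, hm m' hm']
    simp
  · refine (hM.eLpNorm_blockGrad_le b m.1 m.2 i t hp).trans (le_of_eq ?_)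
    have hs := P.scale_pos m.1
    congr 1
    rw [Real.mul_rpow (by norm_num) hs.le, Real.rpow_sub_one hs.ne']
    ring
  · refine tendsto_eLpNorm_of_le (L := 2 ^ m.1 / P.scale m.1 *
      (blockConst d M * P.rate m.1 ^ 2 / P.scale m.1)) (fun s t x => ?_) t
    exact (hM.norm_blockGrad_sub_le b m.1 m.2 i s t x).trans_eq (by ring)

lemma le_rpow_mul_rpow {x a c α : ℝ} (hx : 0 ≤ x) (ha : x ≤ a) (hc : x ≤ c) (h0 : 0 ≤ α)
    (h1 : α ≤ 1) : x ≤ a ^ (1 - α) * c ^ α := by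
  have ha0 : 0 ≤ a := hx.trans ha
  have hα : 0 ≤ 1 - α := by linarith
  calc x = x ^ (1 - α) * x ^ α := by
        rcases hx.eq_or_lt with rfl | hx
        · rcases h0.eq_or_lt with rfl | h0
          · simp
          · rw [Real.zero_rpow h0.ne', mul_zero]
        · rw [← Real.rpow_add hx]; simp
    _ ≤ _ := by
        gcongr

/-- Each difference of a block is bounded both by the supremum, of order `rate / 2 ^ n`, and by the
Lipschitz constant, of order `rate ^ 2 / scale`, times `δ`; the geometric mean with weights `1 - α`
and `α` is the Hölder bound. A change of the active block doubles the constant. -/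
lemma exists_norm_field_sub_le {α : ℝ} (h0 : 0 ≤ α) (h1 : α ≤ 1) {C : ℝ}
    (hC : ∀ n, (P.rate n / 2 ^ n) ^ (1 - α) * (P.rate n ^ 2 / P.scale n) ^ α ≤ C) :
    ∃ K : ℝ≥0, ∀ (b : Torus d) (t t' δ : ℝ) (x x' : Torus d), |t - t'| ≤ δ → ‖x - x'‖ ≤ δ →
      ‖P.field b t x - P.field b t' x'‖ ≤ K * δ ^ α := by
  obtain ⟨M, hM⟩ := P.exists_isBound
  have hM1 := hM.one_le
  have hB : 0 ≤ blockConst d M := by unfold blockConst; positivity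
  set K₀ : ℝ := 2 * blockConst d M * C with hK
  have hC0 : 0 ≤ C := by
    refine le_trans ?_ (hC 0)
    have := P.scale_pos 0
    have := P.one_le_rate 0
    positivity
  have hblock : ∀ (b : Torus d) (m : ℕ × Fin d) (t t' δ : ℝ) (x x' : Torus d),
      |t - t'| ≤ δ → ‖x - x'‖ ≤ δ →
      ‖P.block b m.1 m.2 t x - P.block b m.1 m.2 t' x'‖ ≤ K₀ * δ ^ α := by
    intro b m t t' δ x x' ht hx
    have hδ : 0 ≤ δ := (abs_nonneg _).trans ht
    have hs := P.scale_pos m.1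
    have hR := P.one_le_rate m.1
    have e1 : ‖P.block b m.1 m.2 t x - P.block b m.1 m.2 t' x'‖ ≤
        2 * blockConst d M * (P.rate m.1 / 2 ^ m.1) := by
      refine (norm_sub_le _ _).trans ((add_le_add (hM.norm_block_le b m.1 m.2 t x)
        (hM.norm_block_le b m.1 m.2 t' x')).trans_eq (by ring))
    have e2 : ‖P.block b m.1 m.2 t x - P.block b m.1 m.2 t' x'‖ ≤
        2 * blockConst d M * (P.rate m.1 ^ 2 / P.scale m.1) * δ := by
      refine (hM.norm_block_sub_le b m.1 m.2 ht hx).trans ?_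
      gcongr
      rw [mul_div_assoc]
      gcongr
      linarith
    refine (le_rpow_mul_rpow (norm_nonneg _) e1 e2 h0 h1).trans ?_
    have hN : 0 ≤ P.rate m.1 / 2 ^ m.1 := by positivity
    have hL : 0 ≤ P.rate m.1 ^ 2 / P.scale m.1 := by positivity
    have hB2 : 0 ≤ 2 * blockConst d M := by positivity
    rw [Real.mul_rpow hB2 hN, Real.mul_rpow (mul_nonneg hB2 hL) hδ, Real.mul_rpow hB2 hL]
    have e3 : (2 * blockConst d M) ^ (1 - α) * (2 * blockConst d M) ^ α = 2 * blockConst d M := by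
      rw [← Real.rpow_add' (by positivity) (by simp)]; simp
    calc _ = ((2 * blockConst d M) ^ (1 - α) * (2 * blockConst d M) ^ α) *
          ((P.rate m.1 / 2 ^ m.1) ^ (1 - α) * (P.rate m.1 ^ 2 / P.scale m.1) ^ α) * δ ^ α := by ring
      _ ≤ _ := by rw [e3, hK]; gcongr; exact hC m.1
  have hK0 : 0 ≤ 2 * K₀ := by positivity
  refine ⟨⟨2 * K₀, hK0⟩, fun b t t' δ x x' ht hx => ?_⟩
  have hδ : 0 ≤ δ := (abs_nonneg _).trans ht
  change _ ≤ 2 * K₀ * δ ^ α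
  have hKδ : 0 ≤ K₀ * δ ^ α := by positivity
  obtain ⟨m, hm⟩ := P.exists_term_eq_zero t
  obtain ⟨m', hm'⟩ := P.exists_term_eq_zero t'
  have et : P.field b t x = P.block b m.1 m.2 t x :=
    tsum_eq_single m fun n hn => by rw [block, hm n hn]; rfl
  have et' : P.field b t' x' = P.block b m'.1 m'.2 t' x' :=
    tsum_eq_single m' fun n hn => by rw [block, hm' n hn]; rfl
  rw [et, et']
  by_cases hmm : m = m'
  · subst hmm
    linarith [hblock b m t t' δ x x' ht hx]
  · have z : P.block b m.1 m.2 t' x' = 0 := by rw [block, hm' m hmm]; rfl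
    have z' : P.block b m'.1 m'.2 t x = 0 := by rw [block, hm m' (Ne.symm hmm)]; rfl
    have e : P.block b m.1 m.2 t x - P.block b m'.1 m'.2 t' x' =
        (P.block b m.1 m.2 t x - P.block b m.1 m.2 t' x') +
        (P.block b m'.1 m'.2 t x - P.block b m'.1 m'.2 t' x') := by
      rw [z, z']; simp [sub_eq_add_neg]
    rw [e]
    refine (norm_add_le _ _).trans ?_
    linarith [hblock b m t t' δ x x' ht hx, hblock b m' t t' δ x x' ht hx]

end Setup

/-! ### Dyadic cells and binary digits -/

lemma norm_coe_le_abs (y : ℝ) : ‖(y : UnitAddCircle)‖ ≤ |y| := by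
  rw [UnitAddCircle.norm_eq]
  simpa using round_le y 0

/-- The center of the dyadic interval of generation `n` that contains `y`. -/
def cellCenter (n : ℕ) (y : ℝ) : ℝ := (⌊2 ^ n * y⌋ + 1 / 2) / 2 ^ n

/-- The binary digits of `y`, with values in `{1, -1}`. -/
def digit (n : ℕ) (y : ℝ) : ℤ := 2 * (⌊2 ^ (n + 1) * y⌋ - 2 * ⌊2 ^ n * y⌋) - 1

lemma digit_eq (n : ℕ) (y : ℝ) : digit n y = 1 ∨ digit n y = -1 := by
  have h1 : 2 * ⌊2 ^ n * y⌋ ≤ ⌊2 ^ (n + 1) * y⌋ := by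
    rw [Int.le_floor]
    push_cast
    rw [pow_succ]
    linarith [Int.floor_le (2 ^ n * y)]
  have h2 : ⌊2 ^ (n + 1) * y⌋ < 2 * ⌊2 ^ n * y⌋ + 2 := by
    rw [Int.floor_lt]
    push_cast
    rw [pow_succ]
    linarith [Int.lt_floor_add_one (2 ^ n * y)]
  unfold digit
  omega

lemma digit_cast (n : ℕ) (y : ℝ) : (digit n y : ℝ) = 1 ∨ (digit n y : ℝ) = -1 := by
  rcases digit_eq n y with h | h <;> simp [h]

lemma abs_digit (n : ℕ) (y : ℝ) : |(digit n y : ℝ)| = 1 := by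
  rcases digit_cast n y with h | h <;> simp [h]

lemma cellCenter_succ (n : ℕ) (y : ℝ) :
    cellCenter (n + 1) y = cellCenter n y + digit n y / (4 * 2 ^ n) := by
  simp only [cellCenter, digit]
  push_cast
  field_simp
  ring

lemma abs_cellCenter_sub_le (n : ℕ) (y : ℝ) : |cellCenter n y - y| ≤ (1 / 2) ^ n := by
  have h2 : (0 : ℝ) < 2 ^ n := by positivity
  have e : cellCenter n y - y = (⌊2 ^ n * y⌋ + 1 / 2 - 2 ^ n * y) / 2 ^ n := by
    unfold cellCenter; field_simp
  rw [e, abs_div, abs_of_pos h2, div_pow, one_pow]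
  gcongr
  rw [abs_le]
  constructor <;> linarith [Int.floor_le (2 ^ n * y), Int.lt_floor_add_one (2 ^ n * y)]

lemma summable_digits {k : ℝ} (h0 : 0 ≤ k) (h1 : k < 1) {s : ℕ → ℝ} (hs : ∀ i, |s i| = 1) :
    Summable fun i => s i * k ^ i := by
  refine Summable.of_norm_bounded (summable_geometric_of_lt_one h0 h1) fun i => ?_
  rw [norm_mul, Real.norm_eq_abs, hs, one_mul, Real.norm_of_nonneg (by positivity)]

lemma abs_tsum_digits_le {k : ℝ} (h0 : 0 ≤ k) (h1 : k < 1 / 2) {s : ℕ → ℝ} (hs : ∀ i, |s i| = 1) :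
    |∑' i, s i * k ^ i| ≤ 2 := by
  have := tsum_of_norm_bounded (hasSum_geometric_of_lt_one h0 (by linarith))
    (f := fun i => s i * k ^ i) fun i => by
      rw [norm_mul, Real.norm_eq_abs, hs, one_mul, Real.norm_of_nonneg (by positivity)]
  refine this.trans ?_
  rw [inv_le_comm₀ (by linarith) two_pos]
  linarith

/-! ### The motion of a single coordinate -/

namespace Setup

variable {d : ℕ} (P : Setup d)

/-- The position in the Cantor set, relative to its cube of generation `n`, that is encoded by the
digits of `y` from the `n`-th on. -/
def tail (n : ℕ) (y : ℝ) : ℝ := P.κ ^ 5 / 4 * (P.κ ^ n * ∑' i, (digit (n + i) y : ℝ) * P.κ ^ i)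

lemma tail_succ (n : ℕ) (y : ℝ) :
    P.tail n y = P.κ ^ 5 / 4 * (digit n y * P.κ ^ n) + P.tail (n + 1) y := by
  have hs := summable_digits P.κ_pos.le (by linarith [P.κ_lt]) fun i => abs_digit (n + i) y
  unfold tail
  rw [hs.tsum_eq_zero_add]
  have : ∀ i, (digit (n + (i + 1)) y : ℝ) * P.κ ^ (i + 1) =
      P.κ * (digit (n + 1 + i) y * P.κ ^ i) := fun i => by
    rw [show n + (i + 1) = n + 1 + i by ring, pow_succ]; ring
  simp only [this, tsum_mul_left]
  simp only [add_zero, pow_zero, mul_one]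
  ring

lemma abs_tail_le (n : ℕ) (y : ℝ) : |P.tail n y| ≤ P.κ ^ 5 * P.κ ^ n / 2 := by
  have hκ := P.κ_pos
  have := abs_tsum_digits_le hκ.le P.κ_lt fun i => abs_digit (n + i) y
  unfold tail
  rw [abs_mul, abs_mul, abs_of_pos (by positivity), abs_of_pos (by positivity)]
  calc _ ≤ P.κ ^ 5 / 4 * (P.κ ^ n * 2) := by gcongr
    _ = _ := by ring

/-- The position at which the coordinate with initial value `y` rests between the motions of the
generations `n + 1` and `n`. -/
def rest (n : ℕ) (y : ℝ) : ℝ := cellCenter n y + P.tail n y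

/-- In generation `n` the binary weight `1 / (4 * 2 ^ n)` of the digit is exchanged for the Cantor
weight `κ ^ (n + 5) / 4`, which equals `scale n / 2 ^ n`. -/
lemma rest_sub_rest (n : ℕ) (y : ℝ) :
    P.rest n y - P.rest (n + 1) y = -(digit n y * (1 / 4 - P.scale n) / 2 ^ n) := by
  unfold rest
  rw [cellCenter_succ, P.tail_succ n, scale, mul_pow]
  field_simp
  ring

lemma abs_rest_sub_rest_le (n : ℕ) (y : ℝ) : |P.rest n y - P.rest (n + 1) y| ≤ (1 / 2) ^ n := by
  have h1 := P.scale_pos n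
  have h2 := P.scale_lt n
  rw [P.rest_sub_rest, abs_neg, abs_div, abs_mul, abs_digit, one_mul, abs_of_pos (by linarith),
    abs_of_pos (by positivity), one_div (2 : ℝ), inv_pow, ← one_div]
  gcongr
  linarith

lemma tendsto_rest (y : ℝ) : Tendsto (fun n => P.rest n y) atTop (𝓝 y) := by
  have hκ := P.κ_pos
  have h1 : Tendsto (fun n => cellCenter n y - y) atTop (𝓝 0) :=
    squeeze_zero_norm (fun n => abs_cellCenter_sub_le n y)
      (tendsto_pow_atTop_nhds_zero_of_lt_one (by norm_num) (by norm_num))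
  have h2 : Tendsto (fun n => P.tail n y) atTop (𝓝 0) := by
    refine squeeze_zero_norm (fun n => P.abs_tail_le n y) ?_
    have := (tendsto_pow_atTop_nhds_zero_of_lt_one hκ.le
      (by linarith [P.κ_lt] : P.κ < 1)).const_mul (P.κ ^ 5 / 2)
    rw [mul_zero] at this
    exact this.congr fun n => by ring
  have h3 := (h1.add h2).add_const y
  simp only [add_zero, zero_add] at h3
  exact h3.congr fun n => by unfold rest; ring

lemma tsum_rest_sub_rest (y : ℝ) : ∑' n, (P.rest n y - P.rest (n + 1) y) = P.rest 0 y - y := by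
  have hs : Summable fun n => P.rest n y - P.rest (n + 1) y :=
    Summable.of_norm_bounded (summable_geometric_of_lt_one (by norm_num) (by norm_num))
      fun n => P.abs_rest_sub_rest_le n y
  refine tendsto_nhds_unique hs.hasSum.tendsto_sum_nat ?_
  simp only [Finset.sum_range_sub']
  exact (P.tendsto_rest y).const_sub _

/-- The motion of the `i`-th coordinate with initial value `y`. -/
def coord (i : Fin d) (y t : ℝ) : ℝ :=
  P.rest 0 y - ∑' n, (P.rest n y - P.rest (n + 1) y) * (1 - P.step (P.Q ^ (n * d + i) * t))

lemma coord_zero (i : Fin d) (y : ℝ) : P.coord i y 0 = y := by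
  have : P.step 0 = 0 := P.step_eq_zero (by simpa using P.T_pos.le)
  simp [coord, this, P.tsum_rest_sub_rest]

lemma coord_T (i : Fin d) (y : ℝ) : P.coord i y P.T = P.rest 0 y := by
  have : ∀ n, P.step (P.Q ^ (n * d + i) * P.T) = 1 := fun n =>
    P.step_eq_one (le_mul_of_one_le_left P.T_pos.le (one_le_pow₀ P.one_lt_Q.le))
  simp [coord, this]

/-- While generation `n` moves, finer generations have come to rest and coarser ones have not
started, so the series telescopes up to a single unfinished term. -/
lemma coord_eq {n : ℕ} {j : Fin d} {t : ℝ} (h : deriv P.step (P.Q ^ (n * d + j) * t) ≠ 0)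
    (i : Fin d) (y : ℝ) :
    P.coord i y t = cellCenter n y + digit n y * P.radius n i t / 2 ^ n + P.tail (n + 1) y := by
  have hj := j.2
  have hi := i.2
  have h0 : ∀ n' < n, P.step (P.Q ^ (n' * d + i) * t) = 0 := fun n' hn' => by
    refine P.step_of_gt h ?_
    have : (n' + 1) * d ≤ n * d := Nat.mul_le_mul_right d hn'
    rw [add_mul] at this
    omega
  have h1 : ∀ n', n < n' → P.step (P.Q ^ (n' * d + i) * t) = 1 := fun n' hn' => by
    refine P.step_of_lt h ?_
    have : (n + 1) * d ≤ n' * d := Nat.mul_le_mul_right d hn'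
    rw [add_mul] at this
    omega
  have hsum : ∑' n, (P.rest n y - P.rest (n + 1) y) * (1 - P.step (P.Q ^ (n * d + i) * t)) =
      P.rest 0 y - P.rest n y +
        (P.rest n y - P.rest (n + 1) y) * (1 - P.step (P.Q ^ (n * d + i) * t)) := by
    rw [tsum_eq_sum (s := Finset.range (n + 1)) fun n' hn' => by
      rw [Finset.mem_range, not_lt] at hn'
      rw [h1 n' (by omega)]; ring, Finset.sum_range_succ]
    congr 1
    rw [← Finset.sum_range_sub' (fun n => P.rest n y)]
    refine Finset.sum_congr rfl fun n' hn' => ?_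
    rw [h0 n' (Finset.mem_range.1 hn')]; ring
  have hr := P.rest_sub_rest n y
  rw [coord, hsum, hr]
  have e : P.rest n y = P.rest (n + 1) y - digit n y * (1 / 4 - P.scale n) / 2 ^ n := by
    linarith
  have e' : P.rest (n + 1) y =
      cellCenter n y + digit n y / (4 * 2 ^ n) + P.tail (n + 1) y := by
    rw [rest, cellCenter_succ]
  rw [e, e', radius]
  field_simp
  ring

lemma rest_sub_mul_eq (n : ℕ) (i : Fin d) (y t : ℝ) :
    (P.rest n y - P.rest (n + 1) y) *
      (P.Q ^ (n * d + i) * deriv P.step (P.Q ^ (n * d + i) * t)) = digit n y * P.speed n i t := by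
  rw [P.rest_sub_rest, speed]; ring

lemma rate_div_eq (n : ℕ) : P.rate n / 2 ^ n = P.Q ^ d * (P.Q ^ d / 2) ^ n := by
  rw [rate, mul_comm (n + 1), pow_mul, pow_succ, div_pow]; ring

lemma summable_rate (hQ : P.Q ^ d < 2) : Summable fun n => P.rate n / 2 ^ n := by
  have := P.Q_pos
  simp only [P.rate_div_eq]
  exact (summable_geometric_of_lt_one (by positivity) (by linarith)).mul_left _

variable {P} {M : ℝ}

lemma IsBound.norm_digit_mul_speed_le (hM : P.IsBound M) (n : ℕ) (i : Fin d) (y t : ℝ) :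
    ‖digit n y * P.speed n i t‖ ≤ M * (P.rate n / 2 ^ n) := by
  rw [norm_mul, Real.norm_eq_abs, Real.norm_eq_abs, abs_digit, one_mul, ← mul_div_assoc]
  exact hM.abs_speed_le n i t

lemma hasDerivAt_coord (hQ : P.Q ^ d < 2) (i : Fin d) (y t : ℝ) :
    HasDerivAt (P.coord i y) (∑' n, digit n y * P.speed n i t) t := by
  obtain ⟨M, hM⟩ := P.exists_isBound
  have h1 : ∀ (n : ℕ) (s : ℝ), HasDerivAt
      (fun s => (P.rest n y - P.rest (n + 1) y) * (1 - P.step (P.Q ^ (n * d + i) * s)))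
      (-(digit n y * P.speed n i s)) s := by
    intro n s
    have h := (P.hasDerivAt_step (P.Q ^ (n * d + i) * s)).comp s
      ((hasDerivAt_id s).const_mul (P.Q ^ (n * d + (i : ℕ))))
    refine ((h.const_sub 1).const_mul (P.rest n y - P.rest (n + 1) y)).congr_deriv ?_
    rw [← P.rest_sub_mul_eq]
    ring
  -- The derivatives are dominated uniformly in time because `Q ^ d < 2`, so `t = 0` needs no
  -- separate treatment. The one point of convergence that is required is `T`, where all terms
  -- vanish.
  have h2 := hasDerivAt_tsum ((P.summable_rate hQ).mul_left M) h1
    (fun n s => by rw [norm_neg]; exact hM.norm_digit_mul_speed_le n i y s) (y₀ := P.T) (by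
      have : ∀ n, P.step (P.Q ^ (n * d + i) * P.T) = 1 := fun n =>
        P.step_eq_one (le_mul_of_one_le_left P.T_pos.le (one_le_pow₀ P.one_lt_Q.le))
      simp [this]) t
  refine (h2.const_sub (P.rest 0 y)).congr_deriv ?_
  rw [tsum_neg, neg_neg]

lemma exists_abs_coord_sub_le (hQ : P.Q ^ d < 2) :
    ∃ K : ℝ≥0, ∀ (i : Fin d) (y t t' : ℝ), |P.coord i y t - P.coord i y t'| ≤ K * |t - t'| := by
  obtain ⟨M, hM⟩ := P.exists_isBound
  have hs := (P.summable_rate hQ).mul_left M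
  have hnn : 0 ≤ ∑' n, M * (P.rate n / 2 ^ n) := tsum_nonneg fun n => by
    have := hM.one_le
    have := P.one_le_rate n
    positivity
  refine ⟨⟨_, hnn⟩, fun i y t t' => ?_⟩
  refine Convex.norm_image_sub_le_of_norm_hasDerivWithin_le (s := univ)
    (fun s _ => (hasDerivAt_coord hQ i y s).hasDerivWithinAt) (fun s _ => ?_)
    convex_univ (mem_univ t') (mem_univ t)
  exact tsum_of_norm_bounded hs.hasSum fun n => hM.norm_digit_mul_speed_le n i y s

variable (P)

/-! ### The curves follow their own field and avoid the shifted one -/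

lemma radius_le (n : ℕ) (i : Fin d) (t : ℝ) : P.radius n i t ≤ 1 / 4 := by
  have h1 := P.scale_lt n
  have := mul_nonneg (sub_nonneg.2 h1.le) (P.step_nonneg (P.Q ^ (n * d + i) * t))
  unfold radius; linarith

lemma scale_le_radius (n : ℕ) (i : Fin d) (t : ℝ) : P.scale n ≤ P.radius n i t := by
  have h1 := P.scale_lt n
  have := mul_le_mul_of_nonneg_left (P.step_le_one (P.Q ^ (n * d + i) * t)) (sub_nonneg.2 h1.le)
  unfold radius; linarith

/-- The digits beyond generation `n` move the point only within the fraction `2 * κ < 1` of its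
cube, where `η` and the derivative of `ζ` are constantly `1`. -/
lemma abs_pow_mul_tail_le (n : ℕ) (y : ℝ) :
    |2 ^ n * P.tail (n + 1) y| ≤ 2 * P.κ * P.scale n := by
  rw [abs_mul, abs_of_pos (by positivity)]
  calc _ ≤ 2 ^ n * (P.κ ^ 5 * P.κ ^ (n + 1) / 2) := by gcongr; exact P.abs_tail_le _ _
    _ = _ := by rw [scale, mul_pow, pow_succ]; ring

/-- Multiplication by `2 ^ n` forgets the cell, that is, the integer `⌊2 ^ n * y⌋`, and leaves the
position within the cell, whose center becomes `1 / 2`. -/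
lemma nsmul_coord {n : ℕ} {j : Fin d} {t : ℝ} (h : deriv P.step (P.Q ^ (n * d + j) * t) ≠ 0)
    (i : Fin d) (y : ℝ) :
    (2 ^ n : ℕ) • ((P.coord i y t : ℝ) : UnitAddCircle) =
      ((1 / 2 + digit n y * P.radius n i t + 2 ^ n * P.tail (n + 1) y : ℝ) : UnitAddCircle) := by
  rw [← AddCircle.coe_nsmul, P.coord_eq h, ← coe_sub_int _ ⌊2 ^ n * y⌋]
  congr 1
  rw [nsmul_eq_mul, cellCenter]
  push_cast
  field_simp
  ring

/-- The point of the torus all of whose coordinates are `β`. -/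
def diagonal (d : ℕ) (β : ℝ) : Torus d := fun _ => (β : UnitAddCircle)

/-- The trajectory with initial coordinates `β + y i`. -/
def curve (β : ℝ) (y : Fin d → ℝ) (t : ℝ) : Torus d := fun i =>
  ((β + P.coord i (y i) t : ℝ) : UnitAddCircle)

lemma nsmul_curve {n : ℕ} {j : Fin d} {t : ℝ} (h : deriv P.step (P.Q ^ (n * d + j) * t) ≠ 0)
    (β β' : ℝ) (y : Fin d → ℝ) (i : Fin d) :
    (2 ^ n : ℕ) • (P.curve β y t i - diagonal d β' i) =
      ((1 / 2 + digit n (y i) * P.radius n i t + 2 ^ n * P.tail (n + 1) (y i) +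
        2 ^ n * (β - β') : ℝ) : UnitAddCircle) := by
  have e : P.curve β y t i - diagonal d β' i =
      ((P.coord i (y i) t : ℝ) : UnitAddCircle) + ((β - β' : ℝ) : UnitAddCircle) := by
    rw [curve, diagonal, ← AddCircle.coe_sub, ← AddCircle.coe_add]
    congr 1; ring
  rw [e, nsmul_add, P.nsmul_coord h, ← AddCircle.coe_nsmul, ← AddCircle.coe_add, nsmul_eq_mul]
  push_cast
  rfl

lemma pairBump_curve {n : ℕ} {j : Fin d} {t : ℝ} (h : deriv P.step (P.Q ^ (n * d + j) * t) ≠ 0)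
    (β : ℝ) (y : Fin d → ℝ) (i : Fin d) {φ : ℝ → ℝ} (hφ : IsBump φ) (σ : ℝ) :
    ∃ e, |e| ≤ 2 * P.κ ∧
      pairBump φ σ (P.scale n) (P.radius n i t)
        ((2 ^ n : ℕ) • (P.curve β y t i - diagonal d β i)) =
          (if (digit n (y i) : ℝ) = 1 then 1 else σ) * φ e := by
  have hs := P.scale_pos n
  have hκ := P.κ_lt
  have ht := P.abs_pow_mul_tail_le n (y i)
  refine ⟨2 ^ n * P.tail (n + 1) (y i) / P.scale n, ?_, ?_⟩
  · rw [abs_div, abs_of_pos hs, div_le_iff₀ hs]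
    exact ht
  · refine pairBump_eq hφ hs (P.scale_lt n) (digit_cast n (y i)) (P.scale_le_radius n i t)
      (P.radius_le n i t) (ht.trans ?_) ?_
    · nlinarith
    · rw [P.nsmul_curve h β β y i]
      congr 1; ring

/-- All profiles equal `1` near the curve; the sign comes from the weight `-1` of the second bump in
coordinate `j`, which sends the two halves of a cell in opposite directions. -/
lemma prodBump_profile₁_curve {n : ℕ} {j : Fin d} {t : ℝ}
    (h : deriv P.step (P.Q ^ (n * d + j) * t) ≠ 0) (β : ℝ) (y : Fin d → ℝ) :
    P.prodBump (diagonal d β) n j (P.profile₁ j) t (P.curve β y t) = digit n (y j) := by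
  have hval : ∀ i e, |e| ≤ 2 * P.κ → P.profile₁ j i e = 1 := by
    intro i e he
    by_cases hi : i = P.aux j
    · subst hi; simpa [profile₁] using P.deriv_ζ_eq_one he
    · simpa [profile₁, hi] using P.η_eq_one he
  rw [prodBump, Finset.prod_eq_single j]
  · obtain ⟨e, he, h1⟩ := P.pairBump_curve h β y j (P.isBump_profile₁ j j)
      (if j = j then -1 else 1)
    rw [h1, hval j e he, mul_one]
    rcases digit_cast n (y j) with hd | hd <;> norm_num [hd]
  · intro i _ hij
    obtain ⟨e, he, h1⟩ := P.pairBump_curve h β y i (P.isBump_profile₁ j i)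
      (if i = j then -1 else 1)
    rw [h1, hval i e he]
    simp [hij]
  · simp

lemma prodBump_profile₂_curve {n : ℕ} {j : Fin d} {t : ℝ}
    (h : deriv P.step (P.Q ^ (n * d + j) * t) ≠ 0) (β : ℝ) (y : Fin d → ℝ) :
    P.prodBump (diagonal d β) n j (P.profile₂ j) t (P.curve β y t) = 0 := by
  refine Finset.prod_eq_zero (Finset.mem_univ j) ?_
  obtain ⟨e, he, h1⟩ := P.pairBump_curve h β y j (P.isBump_profile₂ j j)
    (if j = j then -1 else 1)
  rw [h1]
  have : P.profile₂ j j e = 0 := by simpa [profile₂] using P.deriv_η_eq_zero he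
  rw [this, mul_zero]

lemma deriv_step_ne_zero_of_speed {n : ℕ} {j : Fin d} {t : ℝ} (h : P.speed n j t ≠ 0) :
    deriv P.step (P.Q ^ (n * d + j) * t) ≠ 0 := by
  intro h0
  exact h (by simp [speed, h0])

/-- The curves move with the velocity of the field. -/
lemma field_curve (β : ℝ) (y : Fin d → ℝ) (t : ℝ) (i : Fin d) :
    P.field (diagonal d β) t (P.curve β y t) i = ∑' n, digit n (y i) * P.speed n i t := by
  obtain ⟨m, hm⟩ := P.exists_speed_eq_zero (by have := P.two_le; omega) t
  have e : P.field (diagonal d β) t (P.curve β y t) =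
      P.block (diagonal d β) m.1 m.2 t (P.curve β y t) :=
    tsum_eq_single m fun m' hm' => by simp [block, term, hm m' hm']
  have hsum : ∑' n, digit n (y i) * P.speed n i t = digit m.1 (y i) * P.speed m.1 i t :=
    tsum_eq_single m.1 fun n hn => by
      rw [hm (n, i) fun h => hn (congrArg Prod.fst h), mul_zero]
  rw [e, hsum]
  by_cases h0 : P.speed m.1 m.2 t = 0
  · have : P.speed m.1 i t = 0 := by
      by_cases hi : (m.1, i) = m
      · rw [← hi] at h0; exact h0
      · exact hm (m.1, i) hi
    simp [block, term, h0, this]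
  · have hd := P.deriv_step_ne_zero_of_speed h0
    rw [block, term, P.prodBump_profile₁_curve hd, P.prodBump_profile₂_curve hd]
    by_cases hi : i = m.2
    · subst hi
      simp [PiLp.single_apply, mul_comm]
    · rw [hm (m.1, i) fun h => hi (congrArg Prod.snd h)]
      simp [PiLp.single_apply, hi]

/-- The curves avoid the region where the field with origin shifted by `± 1/3` moves. -/
lemma field_shift_curve {β β' : ℝ} {ε : ℤ} (hε : ε = 1 ∨ ε = -1) (hβ : β - β' = ε / 3)
    (y : Fin d → ℝ) (t : ℝ) : P.field (diagonal d β') t (P.curve β y t) = 0 := by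
  obtain ⟨m, hm⟩ := P.exists_speed_eq_zero (by have := P.two_le; omega) t
  have e : P.field (diagonal d β') t (P.curve β y t) =
      P.block (diagonal d β') m.1 m.2 t (P.curve β y t) :=
    tsum_eq_single m fun m' hm' => by simp [block, term, hm m' hm']
  rw [e]
  by_cases h0 : P.speed m.1 m.2 t = 0
  · simp [block, term, h0]
  have hder := P.deriv_step_ne_zero_of_speed h0
  refine P.term_eq_zero _ _ _ (P.isBump_profile₁ m.2) (P.isBump_profile₂ m.2) fun hmem => ?_
  obtain ⟨n, j⟩ := m
  -- Coordinate `j` is in motion and may cross the other family, so the separation is found in a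
  -- coordinate at rest, whose radius is one of the two extreme values.
  set k := P.aux j with hk
  have hkj : (k : ℕ) ≠ j := fun h => P.aux_ne j (Fin.ext h)
  have hs := P.scale_pos n
  have hs' := P.scale_le n
  have hrad : P.radius n k t = 1 / 4 ∨ P.radius n k t = P.scale n := by
    rcases lt_or_gt_of_ne hkj with h | h
    · left; rw [radius, P.step_of_gt hder (by simpa using h)]; ring
    · right; rw [radius, P.step_of_lt hder (by simpa using h)]; ring
  have htail : |2 ^ n * P.tail (n + 1) (y k)| ≤ P.scale n :=
    (P.abs_pow_mul_tail_le n (y k)).trans (by nlinarith [P.κ_lt])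
  have key : ∀ (s : ℝ), s = 1 ∨ s = -1 → P.scale n <
      ‖(((digit n (y k) - s) * P.radius n k t + 2 ^ n * P.tail (n + 1) (y k) + 2 ^ n * (β - β') :
        ℝ) : UnitAddCircle)‖ := by
    intro s hs1
    rw [UnitAddCircle.norm_eq]
    set z := round ((digit n (y k) - s) * P.radius n k t + 2 ^ n * P.tail (n + 1) (y k) +
      2 ^ n * (β - β')) with hz
    -- The difference of the two digit contributions is `0` or `±1/2` at radius `1/4`, and at most
    -- `2 * scale` at radius `scale`. The factor `6` clears the denominators of `1/2` and `1/3`.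
    have hw : ∃ w : ℤ, |6 * ((digit n (y k) - s) * P.radius n k t) - 3 * w| ≤ 12 * P.scale n := by
      rcases hrad with hr | hr
      · rcases digit_cast n (y k) with hd | hd <;> rcases hs1 with rfl | rfl <;> rw [hr, hd]
        · exact ⟨0, by norm_num; linarith⟩
        · exact ⟨1, by norm_num; linarith⟩
        · exact ⟨-1, by norm_num; linarith⟩
        · exact ⟨0, by norm_num; linarith⟩
      · refine ⟨0, ?_⟩
        have : |(digit n (y k) : ℝ) - s| ≤ 2 := by
          rcases digit_cast n (y k) with hd | hd <;> rcases hs1 with rfl | rfl <;> rw [hd] <;>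
            norm_num
        rw [hr, Int.cast_zero, mul_zero, sub_zero, abs_mul, abs_mul, abs_of_pos hs,
          abs_of_pos (by norm_num : (0 : ℝ) < 6)]
        nlinarith
    obtain ⟨w, hw⟩ := hw
    -- If this integer were zero, `3` would divide a power of two.
    have hne : (3 * w + 2 * 2 ^ n * ε - 6 * z : ℤ) ≠ 0 := by
      intro h
      have h3 : (3 : ℤ) ∣ 2 ^ (n + 1) := by
        rcases hε with rfl | rfl
        · exact ⟨2 * z - w, by rw [pow_succ]; linarith⟩
        · exact ⟨w - 2 * z, by rw [pow_succ]; linarith⟩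
      have := Int.Prime.dvd_pow' Nat.prime_three h3
      omega
    have hI : (1 : ℝ) ≤ |(3 * w + 2 * 2 ^ n * ε - 6 * z : ℝ)| := by
      have := Int.one_le_abs hne
      exact_mod_cast this
    by_contra hcon
    rw [not_lt] at hcon
    rw [abs_le] at hw htail hcon
    rw [hβ] at hcon
    -- The error `12 * scale` comes from `hw`, and `6 * scale` each from `htail` and `hcon`.
    have : |(3 * w + 2 * 2 ^ n * ε - 6 * z : ℝ)| ≤ 24 * P.scale n := by
      rw [abs_le]
      constructor <;> linarith [hw.1, hw.2, htail.1, htail.2, hcon.1, hcon.2]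
    linarith
  rcases hmem k with h | h
  · rw [Metric.mem_closedBall, dist_eq_norm, P.nsmul_curve hder, ← AddCircle.coe_sub] at h
    refine absurd h (not_le.2 ((key 1 (Or.inl rfl)).trans_eq ?_))
    congr 2; ring
  · rw [Metric.mem_closedBall, dist_eq_norm, P.nsmul_curve hder, ← AddCircle.coe_sub] at h
    refine absurd h (not_le.2 ((key (-1) (Or.inr rfl)).trans_eq ?_))
    congr 2; ring

variable {P}

/-- The curves are trajectories of any field that has the right value along them. -/
lemma isTrajectory_curve (hQ : P.Q ^ d < 2) (β : ℝ) (y : Fin d → ℝ) {u : ℝ → Torus d → Vec d}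
    (hu : ∀ t, u t (P.curve β y t) = P.field (diagonal d β) t (P.curve β y t)) :
    IsTrajectory P.T u (fun i => ((β + y i : ℝ) : UnitAddCircle)) (P.curve β y) where
  absolutelyContinuous := by
    obtain ⟨K, hK⟩ := exists_abs_coord_sub_le hQ
    refine LipschitzOnWith.absolutelyContinuousOnInterval (K := K)
      (LipschitzOnWith.of_dist_le_mul fun t _ t' _ => ?_)
    refine (dist_pi_le_iff (by positivity)).2 fun i => ?_
    rw [dist_eq_norm, Real.dist_eq, curve, curve, ← AddCircle.coe_sub, add_sub_add_left_eq_sub]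
    exact (norm_coe_le_abs _).trans (hK i (y i) t t')
  start := by
    funext i
    simp only [curve, P.coord_zero]
  ode := by
    refine ⟨fun t => WithLp.toLp 2 fun i => β + P.coord i (y i) t, fun t _ => rfl, fun t _ => ?_⟩
    have h : HasDerivAt (fun t i => β + P.coord i (y i) t)
        (fun i => u t (P.curve β y t) i) t := by
      refine hasDerivAt_pi.2 fun i => ?_
      rw [hu, P.field_curve]
      exact (hasDerivAt_coord hQ i (y i) t).const_add β
    exact ((PiLp.hasFDerivAt_toLp (𝕜 := ℝ) 2 _).comp_hasDerivAt t h).hasDerivWithinAt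

end Setup

/-! ### The Cantor set and the end points of the curves -/

namespace Setup

variable {d : ℕ} (P : Setup d)

lemma volume_closedCube_le (c : Torus d) (l : ℝ) :
    volume (closedCube c l) ≤ ENNReal.ofReal l ^ d := by
  have e : closedCube c l = Set.pi univ fun j => Metric.closedBall (c j) (l / 2) := by
    ext x; simp [closedCube, dist_eq_norm]
  rw [e, volume_pi_pi]
  refine (Finset.prod_le_pow_card _ _ (ENNReal.ofReal l) fun j _ => ?_).trans (by simp)
  rw [AddCircle.volume_closedBall]
  exact ENNReal.ofReal_le_ofReal ((min_le_right _ _).trans_eq (by ring))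

lemma volume_cantorStage_le (n : ℕ) :
    volume (cantorStage d P.ν n) ≤ ENNReal.ofReal (((2 * P.κ) ^ d) ^ n) := by
  have hκ := P.κ_pos
  refine (measure_iUnion_le _).trans ?_
  rw [tsum_fintype]
  refine (Finset.sum_le_sum fun s _ => volume_closedCube_le (cubeCenter P.ν n s) _).trans ?_
  rw [Finset.sum_const, Finset.card_univ, P.cubeLength_eq, nsmul_eq_mul,
    ← ENNReal.ofReal_pow (by positivity), ← ENNReal.ofReal_natCast,
    ← ENNReal.ofReal_mul (by positivity)]
  refine ENNReal.ofReal_le_ofReal (le_of_eq ?_)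
  simp only [Fintype.card_fun, Fintype.card_fin, Fintype.card_units_int]
  push_cast
  rw [mul_pow, mul_pow, ← pow_mul, ← pow_mul, ← pow_mul, mul_comm n d]

lemma volume_cantorSet : volume (cantorSet d P.ν) = 0 := by
  have hκ := P.κ_pos
  have h2 : (2 * P.κ) ^ d < 1 :=
    pow_lt_one₀ (by linarith) (by linarith [P.κ_lt]) (by have := P.two_le; omega)
  have hlim : Tendsto (fun n : ℕ => ENNReal.ofReal (((2 * P.κ) ^ d) ^ n)) atTop (𝓝 0) := by
    simpa using ENNReal.tendsto_ofReal
      (tendsto_pow_atTop_nhds_zero_of_lt_one (by positivity) h2)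
  refine le_antisymm (ge_of_tendsto hlim ?_) zero_le
  filter_upwards [eventually_ge_atTop 1] with n hn
  refine (measure_mono ?_).trans (P.volume_cantorStage_le n)
  exact biInter_subset_of_mem hn

/-- The coordinate of the origin of the dyadic cells: it is chosen such that the center of the torus
is moved to the center of a cube of generation `5` of the Cantor set. -/
def origin : ℝ := 1 / 4 * ∑ k ∈ Finset.range 5, P.κ ^ k

/-- The encoding of the final points of the curves. -/
def code (y : ℝ) (k : ℕ) : ℤˣ := if k < 5 then 1 else if digit (k - 5) y = 1 then 1 else -1

lemma abs_code (y : ℝ) (k : ℕ) : |((code y k : ℤ) : ℝ)| = 1 := by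
  rcases Int.units_eq_one_or (code y k) with h | h <;> simp [h]

/-- The shift by `origin` supplies five leading digits `1` of the Cantor expansion, and the factor
`κ ^ 5` in `tail` turns the binary digits of `y` into the digits that follow. -/
lemma rest_zero_eq {y : ℝ} (hy : y ∈ Ico (0 : ℝ) 1) :
    P.origin + P.rest 0 y = 1 / 2 + 1 / 4 * ∑' k, ((code y k : ℤ) : ℝ) * P.κ ^ k := by
  have hs := summable_digits P.κ_pos.le (by linarith [P.κ_lt]) (abs_code y)
  have hfloor : ⌊y⌋ = 0 := Int.floor_eq_zero_iff.2 hy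
  have h1 : ∀ k ∈ Finset.range 5, ((code y k : ℤ) : ℝ) * P.κ ^ k = P.κ ^ k := fun k hk => by
    simp [code, Finset.mem_range.1 hk]
  have h2 : ∀ k, ((code y (k + 5) : ℤ) : ℝ) * P.κ ^ (k + 5) =
      P.κ ^ 5 * ((digit k y : ℝ) * P.κ ^ k) := fun k => by
    have : ((code y (k + 5) : ℤ) : ℝ) = digit k y := by
      rcases digit_eq k y with h | h <;> simp [code, h]
    rw [this, pow_add]; ring
  rw [← hs.sum_add_tsum_nat_add 5, Finset.sum_congr rfl h1, tsum_congr h2, tsum_mul_left, origin,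
    rest, tail, cellCenter]
  simp only [pow_zero, one_mul, hfloor, zero_add]
  push_cast
  ring

lemma curve_T_mem_cantorSet {y : Fin d → ℝ} (hy : ∀ i, y i ∈ Ico (0 : ℝ) 1) :
    P.curve P.origin y P.T ∈ cantorSet d P.ν := by
  have hκ := P.κ_pos
  refine mem_iInter₂.2 fun n _ => mem_iUnion.2 ⟨fun k j => code (y j) k, fun j => ?_⟩
  have hs := summable_digits hκ.le (by linarith [P.κ_lt]) (abs_code (y j))
  rw [curve, P.coord_T, P.rest_zero_eq (hy j), cubeCenter, ← AddCircle.coe_sub]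
  refine (norm_coe_le_abs _).trans ?_
  simp only [P.cubeLength_eq]
  rw [Fin.sum_univ_eq_sum_range (fun k => ((code (y j) k : ℤ) : ℝ) * P.κ ^ k) n,
    ← hs.sum_add_tsum_nat_add n]
  have e : ∀ k, ((code (y j) (k + n) : ℤ) : ℝ) * P.κ ^ (k + n) =
      P.κ ^ n * (((code (y j) (k + n) : ℤ) : ℝ) * P.κ ^ k) := fun k => by rw [pow_add]; ring
  rw [tsum_congr e, tsum_mul_left]
  -- The series beyond its first `n` terms contributes at most `(1 / 4) * κ ^ n * 2`, exactly half
  -- the side length of a cube of generation `n`.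
  have hle := abs_tsum_digits_le hκ.le P.κ_lt fun k => abs_code (y j) (k + n)
  rw [show ∀ a b c : ℝ, 1 / 2 + 1 / 4 * (a + b * c) - (1 / 2 + 1 / 4 * a) = 1 / 4 * (b * c) from
    fun a b c => by ring, abs_mul, abs_mul, abs_of_pos (by positivity : 0 < P.κ ^ n),
    abs_of_pos (by norm_num : (0 : ℝ) < 1 / 4)]
  calc _ ≤ 1 / 4 * (P.κ ^ n * 2) := by gcongr
    _ = _ := by ring

/-- Relative to its own origin each end point has coordinates within `1/64` of `1/2`, so the
coordinates differ by `-1/3` up to `1/32`, which is never an integer. -/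
lemma curve_T_ne (hd : 0 < d) {y y' : Fin d → ℝ} (hy : ∀ i, y i ∈ Ico (0 : ℝ) 1)
    (hy' : ∀ i, y' i ∈ Ico (0 : ℝ) 1) (β : ℝ) :
    P.curve β y P.T ≠ P.curve (β + 1 / 3) y' P.T := by
  intro h
  have h0 := congrFun h ⟨0, hd⟩
  have hz : ∀ y ∈ Ico (0 : ℝ) 1, |P.rest 0 y - 1 / 2| ≤ 1 / 64 := fun y hy => by
    have h1 := P.abs_tail_le 0 y
    have h2 : P.κ ^ 5 ≤ (1 / 2) ^ 5 := pow_le_pow_left₀ P.κ_pos.le P.κ_lt.le 5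
    have hfloor : ⌊y⌋ = 0 := Int.floor_eq_zero_iff.2 hy
    have e : P.rest 0 y - 1 / 2 = P.tail 0 y := by simp [rest, cellCenter, hfloor]
    rw [e]
    refine h1.trans ?_
    rw [pow_zero, mul_one]
    linarith
  have h1 := abs_le.1 (hz _ (hy ⟨0, hd⟩))
  have h2 := abs_le.1 (hz _ (hy' ⟨0, hd⟩))
  rw [curve, curve, P.coord_T, P.coord_T, ← sub_eq_zero, ← AddCircle.coe_sub,
    AddCircle.coe_eq_zero_iff] at h0
  obtain ⟨z, hz⟩ := h0
  rw [zsmul_eq_mul, mul_one] at hz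
  have l1 : (-1 : ℝ) < z := by rw [hz]; linarith [h1.1, h2.2]
  have l2 : (z : ℝ) < 0 := by rw [hz]; linarith [h1.2, h2.1]
  have l1' : (-1 : ℤ) < z := by exact_mod_cast l1
  have l2' : z < 0 := by exact_mod_cast l2
  omega

/-- The coordinates of `x`, relative to `β`, in `[0,1)`. -/
def offset (β : ℝ) (x : Torus d) (i : Fin d) : ℝ :=
  AddCircle.equivIco 1 0 (x i - (β : UnitAddCircle))

lemma offset_mem (β : ℝ) (x : Torus d) (i : Fin d) : offset β x i ∈ Ico (0 : ℝ) 1 := by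
  have h := (AddCircle.equivIco (1 : ℝ) 0 (x i - (β : UnitAddCircle))).2
  exact ⟨h.1, h.2.trans_eq (zero_add 1)⟩

lemma coe_offset (β : ℝ) (x : Torus d) :
    (fun i => ((β + offset β x i : ℝ) : UnitAddCircle)) = x := by
  funext i
  rw [AddCircle.coe_add, offset, AddCircle.coe_equivIco]
  abel

/-! ### The velocity field and its two families of trajectories -/

/-- The vector field of the theorem: two families of moving cubes. -/
def velocity (t : ℝ) : Torus d → Vec d :=
  P.field (diagonal d P.origin) t + P.field (diagonal d (P.origin + 1 / 3)) t

lemma hasGradient_velocity (t : ℝ) : HasGradient (P.velocity t)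
    fun i => P.fieldGrad (diagonal d P.origin) t i +
      P.fieldGrad (diagonal d (P.origin + 1 / 3)) t i :=
  (P.hasGradient_field _ t).add (P.hasGradient_field _ t)

lemma isDivergenceFree_velocity (t : ℝ) : IsDivergenceFree (P.velocity t) :=
  (P.hasGradient_velocity t).isDivergenceFree fun x => by
    simp only [Pi.add_apply, PiLp.add_apply, Finset.sum_add_distrib, P.sum_fieldGrad, add_zero]

lemma tendsto_eLpNorm_add_sub {p : ℝ≥0∞} (hp : 1 ≤ p) {V W : ℝ → Torus d → Vec d}
    (hVc : ∀ t, Continuous (V t)) (hWc : ∀ t, Continuous (W t)) {t : ℝ}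
    (hV : Tendsto (fun s => eLpNorm (V s - V t) p) (𝓝 t) (𝓝 0))
    (hW : Tendsto (fun s => eLpNorm (W s - W t) p) (𝓝 t) (𝓝 0)) :
    Tendsto (fun s => eLpNorm (V s + W s - (V t + W t)) p) (𝓝 t) (𝓝 0) := by
  have h := hV.add hW
  rw [add_zero] at h
  refine tendsto_of_tendsto_of_tendsto_of_le_of_le tendsto_const_nhds h (fun _ => zero_le)
    fun s => ?_
  rw [add_sub_add_comm]
  exact eLpNorm_add_le
    (integrable_of_continuous ((hVc s).sub (hVc t))).aestronglyMeasurable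
    (integrable_of_continuous ((hWc s).sub (hWc t))).aestronglyMeasurable hp

lemma isContinuousInW1p_velocity {p : ℝ} (hp : 1 ≤ p) (hQ : P.Q ^ d < 2)
    (h : Tendsto (fun n => P.rate n * P.scale n ^ (d / p - 1)) atTop (𝓝 0)) (T : ℝ) :
    IsContinuousInW1p (ENNReal.ofReal p) T P.velocity := by
  have hp' : 1 ≤ ENNReal.ofReal p := by simpa using hp
  have h0 := (P.summable_rate hQ).tendsto_atTop_zero
  refine isContinuousInW1p_of_hasGradient P.hasGradient_velocity (fun t => ?_) fun t i => ?_
  · exact tendsto_eLpNorm_add_sub hp' (fun t => (P.hasGradient_field _ t).continuous)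
      (fun t => (P.hasGradient_field _ t).continuous)
      (P.tendsto_eLpNorm_field_sub hp' h0 _ t) (P.tendsto_eLpNorm_field_sub hp' h0 _ t)
  · exact tendsto_eLpNorm_add_sub (V := fun t => P.fieldGrad _ t i)
      (W := fun t => P.fieldGrad _ t i) hp' (fun t => (P.hasGradient_field _ t).continuous_grad i)
      (fun t => (P.hasGradient_field _ t).continuous_grad i)
      (P.tendsto_eLpNorm_fieldGrad_sub hp h _ t i) (P.tendsto_eLpNorm_fieldGrad_sub hp h _ t i)

lemma isHolder_velocity {α : ℝ} (h0 : 0 ≤ α) (h1 : α ≤ 1) {C : ℝ}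
    (hC : ∀ n, (P.rate n / 2 ^ n) ^ (1 - α) * (P.rate n ^ 2 / P.scale n) ^ α ≤ C) (T : ℝ) :
    IsHolder α.toNNReal T P.velocity := by
  obtain ⟨K, hK⟩ := P.exists_norm_field_sub_le h0 h1 hC
  refine ⟨2 * K, fun z _ z' _ => ?_⟩
  have ht : |z.1 - z'.1| ≤ dist z z' := by
    rw [← Real.dist_eq, Prod.dist_eq]; exact le_max_left _ _
  have hx : ‖z.2 - z'.2‖ ≤ dist z z' := by
    rw [← dist_eq_norm, Prod.dist_eq]; exact le_max_right _ _
  have hle : dist (P.velocity z.1 z.2) (P.velocity z'.1 z'.2) ≤ (2 * K : ℝ≥0) * dist z z' ^ α := by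
    rw [dist_eq_norm, velocity, velocity, Pi.add_apply, Pi.add_apply, add_sub_add_comm]
    refine (norm_add_le _ _).trans ((add_le_add (hK _ _ _ _ _ _ ht hx)
      (hK _ _ _ _ _ _ ht hx)).trans_eq ?_)
    push_cast; ring
  rw [edist_dist, edist_dist, Real.coe_toNNReal _ h0, ENNReal.ofReal_rpow_of_nonneg dist_nonneg h0,
    ← ENNReal.ofReal_coe_nnreal, ← ENNReal.ofReal_mul (by positivity)]
  exact ENNReal.ofReal_le_ofReal hle

variable {P}

lemma isTrajectory_velocity (hQ : P.Q ^ d < 2) (x : Torus d) :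
    IsTrajectory P.T P.velocity x (P.curve P.origin (offset P.origin x)) := by
  have := isTrajectory_curve hQ P.origin (offset P.origin x) (u := P.velocity) fun t => by
    rw [velocity, Pi.add_apply, P.field_shift_curve (β := P.origin) (β' := P.origin + 1 / 3)
      (ε := -1) (Or.inr rfl) (by push_cast; ring), add_zero]
  rwa [coe_offset] at this

lemma isTrajectory_velocity_shift (hQ : P.Q ^ d < 2) (x : Torus d) :
    IsTrajectory P.T P.velocity x
      (P.curve (P.origin + 1 / 3) (offset (P.origin + 1 / 3) x)) := by
  have := isTrajectory_curve hQ (P.origin + 1 / 3) (offset (P.origin + 1 / 3) x)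
    (u := P.velocity) fun t => by
    rw [velocity, Pi.add_apply, P.field_shift_curve (β := P.origin + 1 / 3) (β' := P.origin)
      (ε := 1) (Or.inl rfl) (by push_cast; ring), zero_add]
  rwa [coe_offset] at this

lemma mem_nonuniquenessSet (hQ : P.Q ^ d < 2) (x : Torus d) :
    x ∈ nonuniquenessSet P.T P.velocity :=
  ⟨_, _, isTrajectory_velocity hQ x, isTrajectory_velocity_shift hQ x, P.T,
    ⟨P.T_pos.le, le_rfl⟩, P.curve_T_ne (by have := P.two_le; omega) (offset_mem _ x)
      (offset_mem _ x) P.origin⟩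

/-! ### Asymptotics of the parameters -/

variable (P) in
lemma two_mul_κ : 2 * P.κ = (2 : ℝ) ^ (-P.ν) := by
  rw [κ, neg_add, Real.rpow_add two_pos, Real.rpow_neg_one]
  ring

variable (P) in
lemma rate_eq (n : ℕ) : P.rate n = P.Q ^ d * (P.Q ^ d) ^ n := by
  rw [rate, mul_comm (n + 1), pow_mul, pow_succ]; ring

/-- Up to a constant this is the geometric sequence with ratio `2 ^ (ε - ν * θ)`. -/
lemma tendsto_rate_mul_scale {ε θ : ℝ} (hQ : P.Q ^ d = (2 : ℝ) ^ ε) (h : ε < P.ν * θ) :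
    Tendsto (fun n => P.rate n * P.scale n ^ θ) atTop (𝓝 0) := by
  have hκ := P.κ_pos
  have hr : (2 : ℝ) ^ ε * (2 * P.κ) ^ θ < 1 := by
    rw [two_mul_κ, ← Real.rpow_mul two_pos.le, ← Real.rpow_add two_pos]
    exact Real.rpow_lt_one_of_one_lt_of_neg one_lt_two (by linarith)
  have hlim := (tendsto_pow_atTop_nhds_zero_of_lt_one (by positivity) hr).const_mul
    ((2 : ℝ) ^ ε * (P.κ ^ 5 / 4) ^ θ)
  rw [mul_zero] at hlim
  refine hlim.congr fun n => ?_
  rw [P.rate_eq, hQ, scale, mul_div_right_comm,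
    Real.mul_rpow (x := P.κ ^ 5 / 4) (by positivity) (by positivity), mul_pow _ ((2 * P.κ) ^ θ),
    Real.rpow_pow_comm (by positivity : 0 ≤ 2 * P.κ)]
  ring

/-- Up to a constant the product is geometric, and its ratio has the exponent `(ε - 1) * (1 - α) +
(2 * ε + ν) * α` to base `2`. By `h` this is at most `(1 - α) * (ε - 1 + α)`, which is not positive.
-/
lemma exists_rate_bound {ε α : ℝ} (hQ : P.Q ^ d = (2 : ℝ) ^ ε) (h0 : 0 ≤ α) (h1 : α ≤ 1)
    (h : 2 * ε + P.ν ≤ 1 - α) :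
    ∃ C, ∀ n, (P.rate n / 2 ^ n) ^ (1 - α) * (P.rate n ^ 2 / P.scale n) ^ α ≤ C := by
  have hκ := P.κ_pos
  set A : ℝ := (2 : ℝ) ^ ε with hA
  have hA0 : 0 < A := Real.rpow_pos_of_pos two_pos _
  refine ⟨A ^ (1 - α) * (A ^ 2 / (P.κ ^ 5 / 4)) ^ α, fun n => ?_⟩
  have e1 : P.rate n / 2 ^ n = A * (A / 2) ^ n := by rw [P.rate_div_eq, hQ]
  have e2 : P.rate n ^ 2 / P.scale n = A ^ 2 / (P.κ ^ 5 / 4) * (A ^ 2 / (2 * P.κ)) ^ n := by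
    rw [P.rate_eq, hQ, scale, div_pow, ← pow_mul, mul_comm 2 n, pow_mul]
    field_simp
  have hb : (A / 2) ^ (1 - α) * (A ^ 2 / (2 * P.κ)) ^ α ≤ 1 := by
    have e3 : A / 2 = (2 : ℝ) ^ (ε - 1) := by rw [Real.rpow_sub_one two_ne_zero]
    have e4 : A ^ 2 / (2 * P.κ) = (2 : ℝ) ^ (2 * ε + P.ν) := by
      rw [two_mul_κ, hA, ← Real.rpow_natCast, ← Real.rpow_mul two_pos.le, ← Real.rpow_sub two_pos]
      congr 1; push_cast; ring
    rw [e3, e4, ← Real.rpow_mul two_pos.le, ← Real.rpow_mul two_pos.le, ← Real.rpow_add two_pos]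
    refine Real.rpow_le_one_of_one_le_of_nonpos one_le_two ?_
    nlinarith [P.ν_pos]
  rw [e1, e2, Real.mul_rpow (by positivity) (by positivity),
    Real.mul_rpow (by positivity) (by positivity), ← Real.rpow_pow_comm (by positivity),
    ← Real.rpow_pow_comm (by positivity)]
  calc _ = A ^ (1 - α) * (A ^ 2 / (P.κ ^ 5 / 4)) ^ α *
        ((A / 2) ^ (1 - α) * (A ^ 2 / (2 * P.κ)) ^ α) ^ n := by rw [mul_pow]; ring
    _ ≤ A ^ (1 - α) * (A ^ 2 / (P.κ ^ 5 / 4)) ^ α * 1 := by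
        gcongr
        exact pow_le_one₀ (by positivity) hb
    _ = _ := mul_one _

end Setup

end TorusODE

end

/-! ### Choice of the exponents and conclusion -/

theorem theorem1 (d : ℕ) (hd : 2 ≤ d) (p : ℝ) (hp : 1 ≤ p) (hpd : p < d)
    (α : ℝ) (hα₀ : 0 < α) (hα₁ : α < 1) (T : ℝ) (hT : 0 < T) :
    ∃ u : ℝ → TorusODE.Torus d → TorusODE.Vec d,
      (∀ t ∈ Set.Icc 0 T, TorusODE.IsDivergenceFree (u t)) ∧
      TorusODE.IsContinuousInW1p (ENNReal.ofReal p) T u ∧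
      TorusODE.IsHolder α.toNNReal T u ∧
      (∀ᵐ x : TorusODE.Torus d, x ∈ TorusODE.nonuniquenessSet T u) ∧
      ∃ ν : ℝ, 0 < ν ∧ ν < 1 ∧ MeasureTheory.volume (TorusODE.cantorSet d ν) = 0 ∧
        ∃ X : ℝ → TorusODE.Torus d → TorusODE.Torus d,
          (∀ x, TorusODE.IsTrajectory T u x (fun t => X t x)) ∧
          ∀ x, X T x ∈ TorusODE.cantorSet d ν := by
  have hθ : 0 < (d : ℝ) / p - 1 := by
    rw [sub_pos, one_lt_div (by linarith)]
    exact hpd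
  have hν : 0 < (1 - α) / 2 := by linarith
  -- With `ν = (1 - α) / 2`, the strict bound makes the gradients decay in `L^p` and the last one
  -- gives Hölder continuity. Half of the minimum satisfies both.
  obtain ⟨ε, hε0, hε1, hε2⟩ : ∃ ε : ℝ, 0 < ε ∧ ε < (1 - α) / 2 * (d / p - 1) ∧
      2 * ε + (1 - α) / 2 ≤ 1 - α := by
    have h : 0 < min ((1 - α) / 2 * ((d : ℝ) / p - 1)) ((1 - α) / 2) :=
      lt_min (mul_pos hν hθ) hν
    have h1 := min_le_left ((1 - α) / 2 * ((d : ℝ) / p - 1)) ((1 - α) / 2)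
    have h2 := min_le_right ((1 - α) / 2 * ((d : ℝ) / p - 1)) ((1 - α) / 2)
    exact ⟨min ((1 - α) / 2 * ((d : ℝ) / p - 1)) ((1 - α) / 2) / 2, by linarith, by linarith,
      by linarith⟩
  have hd0 : (0 : ℝ) < d := by exact_mod_cast (by omega : 0 < d)
  let P : TorusODE.Setup d :=
    { T := T
      Q := 2 ^ (ε / d)
      ν := (1 - α) / 2
      T_pos := hT
      one_lt_Q := Real.one_lt_rpow one_lt_two (by positivity)
      ν_pos := hν
      ν_lt_one := by linarith
      two_le := hd }
  have hQ : P.Q ^ d = (2 : ℝ) ^ ε := by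
    change ((2 : ℝ) ^ (ε / d)) ^ d = 2 ^ ε
    rw [← Real.rpow_natCast, ← Real.rpow_mul two_pos.le, div_mul_cancel₀ _ hd0.ne']
  have hQ2 : P.Q ^ d < 2 := by
    rw [hQ]
    calc (2 : ℝ) ^ ε < 2 ^ (1 : ℝ) :=
          Real.rpow_lt_rpow_of_exponent_lt one_lt_two (by linarith)
      _ = 2 := Real.rpow_one 2
  obtain ⟨C, hC⟩ := P.exists_rate_bound hQ hα₀.le hα₁.le hε2
  exact ⟨P.velocity, fun t _ => P.isDivergenceFree_velocity t,
    P.isContinuousInW1p_velocity hp hQ2 (P.tendsto_rate_mul_scale hQ hε1) T,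
    P.isHolder_velocity hα₀.le hα₁.le hC T, .of_forall (P.mem_nonuniquenessSet hQ2),
    P.ν, P.ν_pos, P.ν_lt_one, P.volume_cantorSet,
    fun t x => P.curve P.origin (TorusODE.Setup.offset P.origin x) t,
    P.isTrajectory_velocity hQ2,
    fun x => P.curve_T_mem_cantorSet (TorusODE.Setup.offset_mem _ x)⟩
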